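/- **Definitions.** For a positive integer $p$ and $K=(k_1,\dots,k_p)$ with entries in $\mathbb N_{\ge1}\cup\{\infty\}$, let $$J(K)=\langle s_1,\dots,s_p\mid s_1s_2\cdots s_p=s_2\cdots s_ps_1=\cdots=s_ps_1\cdots s_{p-1},\ s_i^{k_i}=1\text{ if }k_i<\infty\rangle .$$ If $K'=(k_1',\dots,k_p')$ with $k_i'\in\mathbb N_{\ge1}$ dividing $k_i$ (every positive integer divides $\infty$), the generalized $J$-group $J\binom{K}{K'}$ is the normal closure of $\{s_1^{k_1'},\dots,s_p^{k_p'}\}$ in $J(K)$; its reflections are the conjugates in $J(K)$ of the nontrivial (integer) powers of the $s_i^{k_i'}$. Write $p\cdot 1=(1,\dots,1)$ ($p$ entries), and $d\cdot K$ for $K$ repeated $d$ times. For $n,m\ge1$ let $m=qn+r$ with $0\le r<n$. The $J$-braid group $\mathcal B_*^*(n,m)$ has generators $x_1,\dots,x_n,y,z$ and, with $\delta=x_1\cdots x_ny$, relations $$x_1\cdots x_nyz=zx_1\cdots x_ny,$$ $$x_{i+1}\cdots x_nyz\,\delta^{q-1}x_1\cdots x_{i+r}=x_i\cdots x_nyz\,\delta^{q-1}x_1\cdots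 x_{i+r-1}\quad(1\le i\le n-r),$$ $$x_{i+1}\cdots x_nyz\,\delta^{q}x_1\cdots x_{i+r-n}=x_i\cdots x_nyz\,\delta^{q}x_1\cdots x_{i+r-n-1}\quad(n-r+1\le i\le n).$$ The groups $\mathcal B^*(n,m)$, $\mathcal B_*(n,m)$, $\mathcal B(n,m)$ are its quotients by the normal closures of $\{y\}$, $\{z\}$, $\{y,z\}$ respectively. Let $d=\gcd(n,m)$, $K=(k_1,\dots,k_d)\in(\mathbb N_{\ge2}\cup\{\infty\})^d$ and $b,c\in\mathbb N_{\ge2}\cup\{\infty\}$. The torsion quotients $\mathcal B_*^*(n,m;K,b,c)$, $\mathcal B^*(n,m;K,c)$, $\mathcal B_*(n,m;K,b)$, $\mathcal B(n,m;K)$ are obtained from these four groups by imposing $x_i^{k_i}=1$ for $1\le i\le d$, together with $y^b=1$ and $z^c=1$ in the first case, $z^c=1$ in the second, $y^b=1$ in the third (a relation with exponent $\infty$ being omitted). The reflections of a torsion quotient are the nontrivial (integer) powers of the conjugates of the images of the generators $x_1,\dots,x_n$ and (where they are present) $y,z$. A reflection isomorphism, written $\cong_{\rm Ref}$, is a group isomorphism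 mapping the set of reflections onto the set of reflections. **Corollary 4.15.** (i) Let $p,n,m\ge1$, $d=\gcd(n,m)$, $K\in(\mathbb N_{\ge2}\cup\{\infty\})^p$ and $b,c\in\mathbb N_{\ge2}\cup\{\infty\}$. The correspondence $$x_{jp+i}\mapsto s_{p+1}^{\,j}s_is_{p+1}^{-j}\ (0\le j\le n-1,\ 1\le i\le p),\qquad y\mapsto s_{p+1}^n,\qquad z\mapsto s_{p+2}^m$$ induces an injective morphism $\varphi:\mathcal B_*^*(pn,pm;d\cdot K,b,c)\to J(K,bn,cm)$ with image $J\binom{K\ \ bn\ \ cm}{p\cdot1\ \ n\ \ m}$. Through the natural quotient maps, $\varphi$ induces injective morphisms, given by the same formulas on the generators, - $\mathcal B^*(pn,pm;d\cdot K,c)\to J(K,n,cm)$ with image $J\binom{K\ \ n\ \ cm}{p\cdot1\ \ n\ \ m}$, - $\mathcal B_*(pn,pm;d\cdot K,b)\to J(K,bn,m)$ with image $J\binom{K\ \ bn\ \ m}{p\cdot1\ \ n\ \ m}$, - $\mathcal B(pn,pm;d\cdot K)\to J(K,n,m)$ with image $J\binom{K\ \ n\ \ m}{p\cdot1\ \ n\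 \ m}$. Each of these four morphisms maps the set of reflections of the torsion quotient onto the set of reflections of the generalized $J$-group. (ii) Consequently, for $n,m\ge1$, $d=\gcd(n,m)$, $n'=n/d$, $m'=m/d$, $K\in(\mathbb N_{\ge2}\cup\{\infty\})^d$ and $b,c\in\mathbb N_{\ge2}\cup\{\infty\}$, $$\mathcal B_*^*(n,m;K,b,c)\cong_{\rm Ref}J\tbinom{K\ \ bn'\ \ cm'}{d\cdot1\ \ n'\ \ m'},\qquad \mathcal B^*(n,m;K,c)\cong_{\rm Ref}J\tbinom{K\ \ n'\ \ cm'}{d\cdot1\ \ n'\ \ m'},$$ $$\mathcal B_*(n,m;K,b)\cong_{\rm Ref}J\tbinom{K\ \ bn'\ \ m'}{d\cdot1\ \ n'\ \ m'},\qquad \mathcal B(n,m;K)\cong_{\rm Ref}J\tbinom{K\ \ n'\ \ m'}{d\cdot1\ \ n'\ \ m'}.$$ -/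

import Mathlib

/-! ## Generalized `J`-groups

Exponents live in `ℕ∞`, where `⊤` is the exponent `∞` (no torsion relation). Tuples are indexed
from `0`: the entry `i : Fin p` is the `(i+1)`-st one. -/

/-- `{a ^ k}` if the exponent `e` is a finite number `k`, and `∅` if `e = ∞`. -/
def torsionRelator {G : Type*} [Group G] (a : G) (e : ℕ∞) : Set G :=
  {w | ∃ k : ℕ, e = (k : ℕ∞) ∧ w = a ^ k}

/-- The relators of `J(K)`: `s_{i+1} ⋯ s_p s_1 ⋯ s_i = s_1 ⋯ s_p` for every `i`, and
`s_i ^ k_i = 1` if `k_i < ∞`. -/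
def JGroupRels {p : ℕ} (K : Fin p → ℕ∞) : Set (FreeGroup (Fin p)) :=
  {w | ∃ i : ℕ, i < p ∧
    w = (((List.ofFn fun j : Fin p => FreeGroup.of j).rotate i).prod) *
      ((List.ofFn fun j : Fin p => FreeGroup.of j).prod)⁻¹} ∪
  {w | ∃ i : Fin p, w ∈ torsionRelator (FreeGroup.of i) (K i)}

/-- The generalized parent `J`-group `J(K)`. -/
abbrev JGroup {p : ℕ} (K : Fin p → ℕ∞) : Type := PresentedGroup (JGroupRels K)

/-- The generators `s_i` of `J(K)`. -/
def JGroup.s {p : ℕ} (K : Fin p → ℕ∞) (i : Fin p) : JGroup K := PresentedGroup.of i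

/-- The generalized `J`-group `J(K / K')`: the normal closure of the `s_i ^ k'_i` in `J(K)`. -/
def GenJGroup {p : ℕ} (K : Fin p → ℕ∞) (K' : Fin p → ℕ) : Subgroup (JGroup K) :=
  Subgroup.normalClosure (Set.range fun i => JGroup.s K i ^ K' i)

/-- The reflections of `J(K / K')`: the conjugates in `J(K)` of the nontrivial powers of the
`s_i ^ k'_i`. -/
def GenJGroup.reflections {p : ℕ} (K : Fin p → ℕ∞) (K' : Fin p → ℕ) : Set (GenJGroup K K') :=
  {r | r ≠ 1 ∧ ∃ (i : Fin p) (e : ℤ) (g : JGroup K),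
    (r : JGroup K) = g * (JGroup.s K i ^ K' i) ^ e * g⁻¹}

theorem JGroup.s_pow_eq_one {p : ℕ} (K : Fin p → ℕ∞) (i : Fin p) (k : ℕ) (h : K i ∣ (k : ℕ∞)) :
    JGroup.s K i ^ k = 1 := by
  obtain ⟨c, hc⟩ := h
  have key : ∀ l : ℕ, K i = l → JGroup.s K i ^ l = 1 := by
    intro l hl
    have := PresentedGroup.one_of_mem (rels := JGroupRels K)
      (x := FreeGroup.of i ^ l) (Or.inr ⟨i, l, hl, rfl⟩)
    simpa [JGroup.s, PresentedGroup.of] using this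
  have hk : k = 0 ∨ ∃ l c' : ℕ, K i = l ∧ k = l * c' := by
    cases hK : K i with
    | top =>
      left
      rw [hK] at hc
      by_cases h0 : c = 0
      · simpa [h0] using hc
      · simp [ENat.top_mul h0] at hc
    | coe l =>
      rw [hK] at hc
      cases c with
      | top =>
        by_cases h0 : (l : ℕ∞) = 0
        · left; simpa [h0] using hc
        · simp [ENat.mul_top h0] at hc
      | coe c' => right; exact ⟨l, c', rfl, by exact_mod_cast hc⟩
  rcases hk with rfl | ⟨l, c', hl, rfl⟩
  · simp
  · rw [pow_mul, key l hl, one_pow]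

/-- The natural morphism `J(K) → J(L)`, `s_i ↦ s_i`, when `l_i` divides `k_i` for every `i`. -/
def JGroup.proj {p : ℕ} {K L : Fin p → ℕ∞} (h : ∀ i, L i ∣ K i) : JGroup K →* JGroup L :=
  PresentedGroup.toGroup (f := JGroup.s L) (by
    rintro w (⟨i, hi, rfl⟩ | ⟨i, k, hk, rfl⟩)
    · have := PresentedGroup.one_of_mem (rels := JGroupRels L) (Or.inl ⟨i, hi, rfl⟩)
      rw [← this]
      refine congrArg (fun f : FreeGroup (Fin p) →* JGroup L => f _) ?_
      ext j
      simp [JGroup.s, PresentedGroup.of]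
    · simpa using JGroup.s_pow_eq_one L i k (hk ▸ h i))

/-- The tuple `(K, b, c)` obtained from `K = (k_1, …, k_p)` by adding two entries at the end. -/
def extTuple {α : Type*} {p : ℕ} (K : Fin p → α) (b c : α) : Fin (p + 2) → α :=
  Fin.append K ![b, c]

theorem extTuple_dvd {p : ℕ} (K : Fin p → ℕ∞) {b b' c c' : ℕ∞} (hb : b' ∣ b) (hc : c' ∣ c)
    (i : Fin (p + 2)) : extTuple K b' c' i ∣ extTuple K b c i := by
  refine Fin.addCases (fun i => ?_) (fun i => ?_) i
  · simp [extTuple]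
  · fin_cases i
    · simpa [extTuple] using hb
    · simpa [extTuple] using hc

/-- The natural morphism `J(K, b, c) → J(K, b', c')` when `b' ∣ b` and `c' ∣ c`. -/
def JGroup.extProj {p : ℕ} (K : Fin p → ℕ∞) {b b' c c' : ℕ∞} (hb : b' ∣ b) (hc : c' ∣ c) :
    JGroup (extTuple K b c) →* JGroup (extTuple K b' c') :=
  JGroup.proj (extTuple_dvd K hb hc)

/-! ## `J`-braid groups -/

/-- The generators `x_1, …, x_n, y, z`; here `x i` with `i : Fin n` is `x_{i+1}`. -/
inductive JBraidGen (n : ℕ) : Type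
  | x (i : Fin n)
  | y
  | z

namespace JBraid

/-- The word `x_1 ⋯ x_k` (for `0 ≤ k ≤ n`). -/
def xInit (n k : ℕ) : FreeGroup (JBraidGen n) :=
  ((List.ofFn fun i : Fin n => FreeGroup.of (JBraidGen.x i)).take k).prod

/-- The word `x_k ⋯ x_n` (for `1 ≤ k ≤ n + 1`; empty for `k = n + 1`). -/
def xTail (n k : ℕ) : FreeGroup (JBraidGen n) :=
  ((List.ofFn fun i : Fin n => FreeGroup.of (JBraidGen.x i)).drop (k - 1)).prod

/-- The word `y`. -/
def wy (n : ℕ) : FreeGroup (JBraidGen n) := FreeGroup.of JBraidGen.y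

/-- The word `z`. -/
def wz (n : ℕ) : FreeGroup (JBraidGen n) := FreeGroup.of JBraidGen.z

/-- The word `δ = x_1 ⋯ x_n y`. -/
def delta (n : ℕ) : FreeGroup (JBraidGen n) := xInit n n * wy n

/-- The relators of the `J`-braid group with both `y` and `z`, where `m = q n + r` is the
Euclidean division, so that `q = m / n` and `r = m % n`. -/
def rels (n m : ℕ) : Set (FreeGroup (JBraidGen n)) :=
  -- `x_1 ⋯ x_n y z = z x_1 ⋯ x_n y`
  {(xInit n n * wy n * wz n) * (wz n * xInit n n * wy n)⁻¹} ∪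
  -- `x_{i+1} ⋯ x_n y z δ^{q-1} x_1 ⋯ x_{i+r} = x_i ⋯ x_n y z δ^{q-1} x_1 ⋯ x_{i+r-1}`
  -- for `1 ≤ i ≤ n - r`
  {w | ∃ i : ℕ, 1 ≤ i ∧ i ≤ n - m % n ∧
    w = (xTail n (i + 1) * wy n * wz n * delta n ^ (((m / n : ℕ) : ℤ) - 1)
          * xInit n (i + m % n)) *
        (xTail n i * wy n * wz n * delta n ^ (((m / n : ℕ) : ℤ) - 1)
          * xInit n (i + m % n - 1))⁻¹} ∪
  -- `x_{i+1} ⋯ x_n y z δ^q x_1 ⋯ x_{i+r-n} = x_i ⋯ x_n y z δ^q x_1 ⋯ x_{i+r-n-1}`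
  -- for `n - r + 1 ≤ i ≤ n`
  {w | ∃ i : ℕ, n - m % n + 1 ≤ i ∧ i ≤ n ∧
    w = (xTail n (i + 1) * wy n * wz n * delta n ^ (m / n)
          * xInit n (i + m % n - n)) *
        (xTail n i * wy n * wz n * delta n ^ (m / n)
          * xInit n (i + m % n - n - 1))⁻¹}

/-- The `J`-braid group `𝓑_*^*(n, m)`, generated by `x_1, …, x_n, y, z`. -/
abbrev Both (n m : ℕ) : Type := PresentedGroup (rels n m)

/-- The generators of `𝓑_*^*(n, m)`. -/
def Both.gen {n m : ℕ} (a : JBraidGen n) : Both n m := PresentedGroup.of a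

/-- The `J`-braid group `𝓑^*(n, m)`: the quotient of `𝓑_*^*(n, m)` by `y = 1`. -/
abbrev Up (n m : ℕ) : Type :=
  Both n m ⧸ Subgroup.normalClosure {(Both.gen .y : Both n m)}

/-- The images in `𝓑^*(n, m)` of `x_1, …, x_n, y, z` (where `y` becomes `1`). -/
def Up.gen {n m : ℕ} (a : JBraidGen n) : Up n m := (Both.gen a : Both n m)

/-- The `J`-braid group `𝓑_*(n, m)`: the quotient of `𝓑_*^*(n, m)` by `z = 1`. -/
abbrev Low (n m : ℕ) : Type :=
  Both n m ⧸ Subgroup.normalClosure {(Both.gen .z : Both n m)}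

/-- The images in `𝓑_*(n, m)` of `x_1, …, x_n, y, z` (where `z` becomes `1`). -/
def Low.gen {n m : ℕ} (a : JBraidGen n) : Low n m := (Both.gen a : Both n m)

/-- The `J`-braid group `𝓑(n, m)`: the quotient of `𝓑_*^*(n, m)` by `y = z = 1`. -/
abbrev Circ (n m : ℕ) : Type :=
  Both n m ⧸ Subgroup.normalClosure {(Both.gen .y : Both n m), (Both.gen .z : Both n m)}

/-- The images in `𝓑(n, m)` of `x_1, …, x_n, y, z` (where `y` and `z` become `1`). -/
def Circ.gen {n m : ℕ} (a : JBraidGen n) : Circ n m := (Both.gen a : Both n m)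

/-! ### Torsion quotients -/

/-- The relators `x_1 ^ k_1, …, x_d ^ k_d` (those with `k_i < ∞`), where `d = gcd(n, m)`, in a group
`B` in which the generators are given by `gen`. -/
def xTorsion {n m : ℕ} {B : Type*} [Group B] (gen : JBraidGen n → B)
    (K : Fin (Nat.gcd n m) → ℕ∞) : Set B :=
  {w | ∃ (i : Fin (Nat.gcd n m)) (l : Fin n), (l : ℕ) = (i : ℕ) ∧
    w ∈ torsionRelator (gen (.x l)) (K i)}

/-- The normal subgroup of `𝓑_*^*(n, m)` defining `𝓑_*^*(n, m; K, b, c)`. -/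
def torsionBoth (n m : ℕ) (K : Fin (Nat.gcd n m) → ℕ∞) (b c : ℕ∞) : Subgroup (Both n m) :=
  Subgroup.normalClosure
    (xTorsion Both.gen K ∪ torsionRelator (Both.gen .y) b ∪ torsionRelator (Both.gen .z) c)

/-- The normal subgroup of `𝓑^*(n, m)` defining `𝓑^*(n, m; K, c)`. -/
def torsionUp (n m : ℕ) (K : Fin (Nat.gcd n m) → ℕ∞) (c : ℕ∞) : Subgroup (Up n m) :=
  Subgroup.normalClosure (xTorsion Up.gen K ∪ torsionRelator (Up.gen .z) c)

/-- The normal subgroup of `𝓑_*(n, m)` defining `𝓑_*(n, m; K, b)`. -/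
def torsionLow (n m : ℕ) (K : Fin (Nat.gcd n m) → ℕ∞) (b : ℕ∞) : Subgroup (Low n m) :=
  Subgroup.normalClosure (xTorsion Low.gen K ∪ torsionRelator (Low.gen .y) b)

/-- The normal subgroup of `𝓑(n, m)` defining `𝓑(n, m; K)`. -/
def torsionCirc (n m : ℕ) (K : Fin (Nat.gcd n m) → ℕ∞) : Subgroup (Circ n m) :=
  Subgroup.normalClosure (xTorsion Circ.gen K)

instance torsionBoth_normal (n m : ℕ) (K : Fin (Nat.gcd n m) → ℕ∞) (b c : ℕ∞) :
    (torsionBoth n m K b c).Normal := Subgroup.normalClosure_normal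

instance torsionUp_normal (n m : ℕ) (K : Fin (Nat.gcd n m) → ℕ∞) (c : ℕ∞) :
    (torsionUp n m K c).Normal := Subgroup.normalClosure_normal

instance torsionLow_normal (n m : ℕ) (K : Fin (Nat.gcd n m) → ℕ∞) (b : ℕ∞) :
    (torsionLow n m K b).Normal := Subgroup.normalClosure_normal

instance torsionCirc_normal (n m : ℕ) (K : Fin (Nat.gcd n m) → ℕ∞) :
    (torsionCirc n m K).Normal := Subgroup.normalClosure_normal

/-- The torsion quotient `𝓑_*^*(n, m; K, b, c)`. -/
abbrev TBoth (n m : ℕ) (K : Fin (Nat.gcd n m) → ℕ∞) (b c : ℕ∞) : Type :=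
  Both n m ⧸ torsionBoth n m K b c

/-- The torsion quotient `𝓑^*(n, m; K, c)`. -/
abbrev TUp (n m : ℕ) (K : Fin (Nat.gcd n m) → ℕ∞) (c : ℕ∞) : Type :=
  Up n m ⧸ torsionUp n m K c

/-- The torsion quotient `𝓑_*(n, m; K, b)`. -/
abbrev TLow (n m : ℕ) (K : Fin (Nat.gcd n m) → ℕ∞) (b : ℕ∞) : Type :=
  Low n m ⧸ torsionLow n m K b

/-- The torsion quotient `𝓑(n, m; K)`. -/
abbrev TCirc (n m : ℕ) (K : Fin (Nat.gcd n m) → ℕ∞) : Type :=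
  Circ n m ⧸ torsionCirc n m K

/-- The images of the generators in `𝓑_*^*(n, m; K, b, c)`. -/
def TBoth.gen {n m : ℕ} (K : Fin (Nat.gcd n m) → ℕ∞) (b c : ℕ∞) (a : JBraidGen n) :
    TBoth n m K b c := (Both.gen a : Both n m)

/-- The images of the generators in `𝓑^*(n, m; K, c)`. -/
def TUp.gen {n m : ℕ} (K : Fin (Nat.gcd n m) → ℕ∞) (c : ℕ∞) (a : JBraidGen n) :
    TUp n m K c := (Up.gen a : Up n m)

/-- The images of the generators in `𝓑_*(n, m; K, b)`. -/
def TLow.gen {n m : ℕ} (K : Fin (Nat.gcd n m) → ℕ∞) (b : ℕ∞) (a : JBraidGen n) :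
    TLow n m K b := (Low.gen a : Low n m)

/-- The images of the generators in `𝓑(n, m; K)`. -/
def TCirc.gen {n m : ℕ} (K : Fin (Nat.gcd n m) → ℕ∞) (a : JBraidGen n) :
    TCirc n m K := (Circ.gen a : Circ n m)

/-! ### Natural morphisms between torsion quotients -/

/-- The natural morphism `𝓑_*^*(n, m; K, b, c) → 𝓑^*(n, m; K, c)`, given by `y = 1`. -/
def TBoth.toUp {n m : ℕ} (K : Fin (Nat.gcd n m) → ℕ∞) (b c : ℕ∞) :
    TBoth n m K b c →* TUp n m K c :=
  QuotientGroup.map (torsionBoth n m K b c) (torsionUp n m K c) (QuotientGroup.mk' _) (by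
    refine Subgroup.normalClosure_le_normal ?_
    have hy : ((Both.gen .y : Both n m) : Up n m) = 1 :=
      (QuotientGroup.eq_one_iff _).2 (Subgroup.subset_normalClosure (by simp))
    rintro w ((⟨i, l, hl, k, hk, rfl⟩ | ⟨k, hk, rfl⟩) | ⟨k, hk, rfl⟩)
    · exact Subgroup.subset_normalClosure (Or.inl ⟨i, l, hl, k, hk, rfl⟩)
    · simp [hy]
    · exact Subgroup.subset_normalClosure (Or.inr ⟨k, hk, rfl⟩))

/-- The natural morphism `𝓑_*^*(n, m; K, b, c) → 𝓑_*(n, m; K, b)`, given by `z = 1`. -/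
def TBoth.toLow {n m : ℕ} (K : Fin (Nat.gcd n m) → ℕ∞) (b c : ℕ∞) :
    TBoth n m K b c →* TLow n m K b :=
  QuotientGroup.map (torsionBoth n m K b c) (torsionLow n m K b) (QuotientGroup.mk' _) (by
    refine Subgroup.normalClosure_le_normal ?_
    have hz : ((Both.gen .z : Both n m) : Low n m) = 1 :=
      (QuotientGroup.eq_one_iff _).2 (Subgroup.subset_normalClosure (by simp))
    rintro w ((⟨i, l, hl, k, hk, rfl⟩ | ⟨k, hk, rfl⟩) | ⟨k, hk, rfl⟩)
    · exact Subgroup.subset_normalClosure (Or.inl ⟨i, l, hl, k, hk, rfl⟩)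
    · exact Subgroup.subset_normalClosure (Or.inr ⟨k, hk, rfl⟩)
    · simp [hz])

/-- The natural morphism `𝓑_*^*(n, m; K, b, c) → 𝓑(n, m; K)`, given by `y = z = 1`. -/
def TBoth.toCirc {n m : ℕ} (K : Fin (Nat.gcd n m) → ℕ∞) (b c : ℕ∞) :
    TBoth n m K b c →* TCirc n m K :=
  QuotientGroup.map (torsionBoth n m K b c) (torsionCirc n m K) (QuotientGroup.mk' _) (by
    refine Subgroup.normalClosure_le_normal ?_
    have hy : ((Both.gen .y : Both n m) : Circ n m) = 1 :=
      (QuotientGroup.eq_one_iff _).2 (Subgroup.subset_normalClosure (by simp))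
    have hz : ((Both.gen .z : Both n m) : Circ n m) = 1 :=
      (QuotientGroup.eq_one_iff _).2 (Subgroup.subset_normalClosure (by simp))
    rintro w ((⟨i, l, hl, k, hk, rfl⟩ | ⟨k, hk, rfl⟩) | ⟨k, hk, rfl⟩)
    · exact Subgroup.subset_normalClosure ⟨i, l, hl, k, hk, rfl⟩
    · simp [hy]
    · simp [hz])

/-! ### Reflections -/

/-- The reflections of a quotient `B ⧸ N` of a group `B` with a set `S` of generators: the
nontrivial powers of the conjugates of the images in `B ⧸ N` of the braid reflections of `B`,
which are the conjugates in `B` of the elements of `S`. -/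
def quotientReflections {B : Type*} [Group B] (S : Set B) (N : Subgroup B) [N.Normal] :
    Set (B ⧸ N) :=
  {r | r ≠ 1 ∧ ∃ β ∈ Group.conjugatesOfSet S, ∃ (h : B ⧸ N) (e : ℤ),
    r = (h * (β : B ⧸ N) * h⁻¹) ^ e}

/-- The set of reflections of `𝓑_*^*(n, m; K, b, c)`. -/
def TBoth.reflections (n m : ℕ) (K : Fin (Nat.gcd n m) → ℕ∞) (b c : ℕ∞) :
    Set (TBoth n m K b c) :=
  quotientReflections (Set.range Both.gen) (torsionBoth n m K b c)

/-- The set of reflections of `𝓑^*(n, m; K, c)`. -/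
def TUp.reflections (n m : ℕ) (K : Fin (Nat.gcd n m) → ℕ∞) (c : ℕ∞) : Set (TUp n m K c) :=
  quotientReflections ((Set.range fun i => Up.gen (.x i)) ∪ {Up.gen .z}) (torsionUp n m K c)

/-- The set of reflections of `𝓑_*(n, m; K, b)`. -/
def TLow.reflections (n m : ℕ) (K : Fin (Nat.gcd n m) → ℕ∞) (b : ℕ∞) : Set (TLow n m K b) :=
  quotientReflections ((Set.range fun i => Low.gen (.x i)) ∪ {Low.gen .y}) (torsionLow n m K b)

/-- The set of reflections of `𝓑(n, m; K)`. -/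
def TCirc.reflections (n m : ℕ) (K : Fin (Nat.gcd n m) → ℕ∞) : Set (TCirc n m K) :=
  quotientReflections (Set.range fun i => Circ.gen (.x i)) (torsionCirc n m K)

/-! ### The embedding on generators -/

/-- The tuple `d · K` of length `gcd(pn, pm) = d p`, where `d = gcd(n, m)`, obtained by repeating
`K = (k_1, …, k_p)` `d` times. -/
def repeatTuple {p : ℕ} (n m : ℕ) (K : Fin p → ℕ∞) : Fin (Nat.gcd (p * n) (p * m)) → ℕ∞ :=
  fun i => Fin.repeat (Nat.gcd n m) K (Fin.cast (by rw [Nat.gcd_mul_left, mul_comm]) i)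

/-- The correspondence on generators
`x_{jp+i} ↦ s_{p+1}^j s_i s_{p+1}^{-j}` (`0 ≤ j < n`, `1 ≤ i ≤ p`),
`y ↦ s_{p+1}^n`, `z ↦ s_{p+2}^m`, with values in `J(K, b, c)`. -/
def embeddingGen {p : ℕ} (n m : ℕ) (K : Fin p → ℕ∞) (b c : ℕ∞) :
    JBraidGen (p * n) → JGroup (extTuple K b c)
  | .x l =>
    let i : Fin p := ⟨(l : ℕ) % p, Nat.mod_lt _ (Nat.pos_of_mul_pos_right l.pos)⟩
    let j : ℕ := (l : ℕ) / p
    JGroup.s _ (Fin.natAdd p 0) ^ j * JGroup.s _ (Fin.castAdd 2 i) *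
      (JGroup.s _ (Fin.natAdd p 0) ^ j)⁻¹
  | .y => JGroup.s _ (Fin.natAdd p 0) ^ n
  | .z => JGroup.s _ (Fin.natAdd p 1) ^ m

end JBraid

/-- `f : W → J(K)` exhibits the group `W`, with set of reflections `R`, as the generalized `J`-group
`J(K / K')`: it is injective, its image is `J(K / K')`, and it sends the set of reflections of `W`
onto that of `J(K / K')`. -/
def ExhibitsAs {W : Type*} [Group W] (R : Set W) {p : ℕ} (K : Fin p → ℕ∞) (K' : Fin p → ℕ)
    (f : W →* JGroup K) : Prop :=
  Function.Injective f ∧ f.range = GenJGroup K K' ∧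
    f '' R = Subtype.val '' GenJGroup.reflections K K'

/-- `W`, with set of reflections `R`, is reflection isomorphic to the group `W'`, with set of
reflections `R'`. -/
def ReflIso {W W' : Type*} [Group W] [Group W'] (R : Set W) (R' : Set W') : Prop :=
  ∃ f : W ≃* W', f '' R = R'

open JBraid

/-! Extend the generators to a sequence indexed by `ℕ`, starting at `0`, by `x_{l+N} = y x_l y⁻¹`,
and put `P_k = x_0 ⋯ x_{k-1}` and `W = z P_M`. The Euclidean division in the presentation then
disappears: the relations of `𝓑_*^*(N, M)` say exactly that `x_l W = W x_{l+M}` for all `l` and that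
`y` commutes with `W` (`lift_rels_iff`). So conjugation by `y` translates the indices by `N`, and
conjugation by `W⁻¹` translates them by `M`.

If `N = pn` and `M = pm`, these relations are stable under translation by `p`, with `y` and `W`
fixed and `z ↦ P_p⁻¹ z P_p`. This gives an endomorphism `α` of the torsion quotient `G` whose `n`-th
iterate is conjugation by `y` (`exists_translation`). Two cyclic extensions follow
(`exists_extension`). The first adjoins `t` acting as `α`, with `t^n = y`; in it `w = W t^m = z (P_p
t)^m` is central. The second adjoins a central `Z` with `Z^m = w`, and `u = (P_p t)⁻¹ Z` satisfies
`u^m = z`. Now `x_0, …, x_{p-1}, t, u` have central product `Z`, which is the defining property of a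
parent `J`-group.

Conversely, the formulas of the correspondence respect the relations (`seqRelations_of_central`),
whence `φ : G → J`. The map `J → E` to the extension just built composes with `φ` to the embedding
`G → E`, so `φ` is injective. Conjugation by `t` acts on the image as `α`, which sends generators to
conjugates of generators, and `u` is a product of `t⁻¹`, an element of the image and a central
element. Hence the image is normal and `J` permutes the conjugates of the generators; this
identifies both the image and the reflections (`exhibitsAs_of_conj`).

The conditions `y = 1` and `z = 1` are the torsion exponents `b = 1` and `c = 1`, so one argument
serves all four families. -/

/-! ### Partial products of a sequence -/

/-- The product `x 0 * x 1 * ⋯ * x (k - 1)`. -/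
def prodTo {H : Type*} [Monoid H] (x : ℕ → H) : ℕ → H
  | 0 => 1
  | k + 1 => prodTo x k * x k

section prodTo

variable {H H' : Type*} [Group H] [Group H']

theorem prodTo_zero (x : ℕ → H) : prodTo x 0 = 1 := rfl

theorem prodTo_succ (x : ℕ → H) (k : ℕ) : prodTo x (k + 1) = prodTo x k * x k := rfl

theorem prodTo_add (x : ℕ → H) (a b : ℕ) :
    prodTo x (a + b) = prodTo x a * prodTo (fun l => x (l + a)) b := by
  induction b with
  | zero => simp [prodTo_zero]
  | succ b ih => rw [← add_assoc, prodTo_succ, prodTo_succ, ih, mul_assoc, add_comm a b]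

theorem map_prodTo (φ : H →* H') (x : ℕ → H) (k : ℕ) :
    φ (prodTo x k) = prodTo (fun l => φ (x l)) k := by
  induction k with
  | zero => simp [prodTo_zero]
  | succ k ih => simp [prodTo_succ, ih]

theorem prodTo_conj (x : ℕ → H) (g : H) (k : ℕ) :
    prodTo (fun l => g * x l * g⁻¹) k = g * prodTo x k * g⁻¹ := by
  simpa using (map_prodTo (MulAut.conj g).toMonoidHom x k).symm

theorem prodTo_semiconj {x x' : ℕ → H} {g : H} (h : ∀ l, x l * g = g * x' l) (k : ℕ) :
    prodTo x k * g = g * prodTo x' k := by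
  induction k with
  | zero => simp [prodTo_zero]
  | succ k ih => rw [prodTo_succ, prodTo_succ, mul_assoc, h, ← mul_assoc, ih, mul_assoc]

theorem take_ofFn_prod {n : ℕ} {f : Fin n → H} {x : ℕ → H} (h : ∀ l : Fin n, x l = f l) {k : ℕ}
    (hk : k ≤ n) : ((List.ofFn f).take k).prod = prodTo x k := by
  induction k with
  | zero => simp [prodTo_zero]
  | succ k ih =>
    rw [List.prod_take_succ _ _ (by simpa using hk), ih (by omega), prodTo_succ]
    simp [← h]

theorem ofFn_prod {n : ℕ} {f : Fin n → H} {x : ℕ → H} (h : ∀ l : Fin n, x l = f l) :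
    (List.ofFn f).prod = prodTo x n := by
  rw [← take_ofFn_prod h le_rfl, List.take_of_length_le (by simp)]

theorem drop_ofFn_prod {n : ℕ} {f : Fin n → H} {x : ℕ → H} (h : ∀ l : Fin n, x l = f l) {k : ℕ}
    (hk : k ≤ n) : ((List.ofFn f).drop k).prod = (prodTo x k)⁻¹ * prodTo x n := by
  rw [← take_ofFn_prod h hk, ← ofFn_prod h, eq_inv_mul_iff_mul_eq, List.prod_take_mul_prod_drop]

/-- A sequence on which translation by `N` acts as conjugation by `y`: its partial products. -/
theorem prodTo_mul_add {x : ℕ → H} {y : H} {N : ℕ} (hs : ∀ l, x (l + N) = y * x l * y⁻¹)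
    (q k : ℕ) : prodTo x (q * N + k) = (prodTo x N * y) ^ q * prodTo x k * (y ^ q)⁻¹ := by
  induction q generalizing k with
  | zero => simp
  | succ q ih =>
    rw [show (q + 1) * N + k = q * N + (N + k) by ring, ih, prodTo_add x N k]
    simp only [hs, prodTo_conj, pow_succ]
    group

/-- Writing `l = l % N + N * (l / N)` forces the value at `l`: the quotient is the exponent of the
conjugating power of `y`. -/
theorem exists_conj_periodic {N : ℕ} (hN : 0 < N) (f : Fin N → H) (y : H) :
    ∃ x : ℕ → H, (∀ l : Fin N, x l = f l) ∧ ∀ l, x (l + N) = y * x l * y⁻¹ := by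
  refine ⟨fun l => y ^ (l / N) * f ⟨l % N, Nat.mod_lt _ hN⟩ * (y ^ (l / N))⁻¹, fun l => ?_,
    fun l => ?_⟩
  · simp [Nat.div_eq_of_lt l.2, Nat.mod_eq_of_lt l.2]
  · simp only [Nat.add_div_right l hN, Nat.add_mod_right, pow_succ']
    group

end prodTo

/-! ### The relations of `J`-braid groups in terms of a conjugation-periodic sequence -/

namespace JBraid

variable {H H' : Type*} [Group H] [Group H']

/-- The relations of `𝓑_*^*(N, M)`, written with the sequence `x_l` extended to all `l` by
`x_{l + N} = y x_l y⁻¹` and the element `z x_1 ⋯ x_M`. -/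
structure SeqRelations (N M : ℕ) (x : ℕ → H) (y z : H) : Prop where
  shift : ∀ l, x (l + N) = y * x l * y⁻¹
  x_comm : ∀ l, x l * (z * prodTo x M) = z * prodTo x M * x (l + M)
  y_comm : y * (z * prodTo x M) = z * prodTo x M * y

theorem lift_xInit {n k : ℕ} {f : JBraidGen n → H} {x : ℕ → H} (h : ∀ l : Fin n, x l = f (.x l))
    (hk : k ≤ n) : FreeGroup.lift f (xInit n k) = prodTo x k := by
  rw [xInit, map_list_prod, List.map_take, List.map_ofFn, ← take_ofFn_prod h hk]
  congr 3
  ext l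
  simp

theorem lift_xTail {n k : ℕ} {f : JBraidGen n → H} {x : ℕ → H} (h : ∀ l : Fin n, x l = f (.x l))
    (hk : k ≤ n) : FreeGroup.lift f (xTail n (k + 1)) = (prodTo x k)⁻¹ * prodTo x n := by
  rw [xTail, map_list_prod, List.map_drop, List.map_ofFn, Nat.add_sub_cancel,
    ← drop_ofFn_prod h hk]
  congr 3
  ext l
  simp

theorem lift_delta {n : ℕ} {f : JBraidGen n → H} {x : ℕ → H} (h : ∀ l : Fin n, x l = f (.x l)) :
    FreeGroup.lift f (delta n) = prodTo x n * f .y := by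
  simp [delta, lift_xInit h le_rfl, wy]

/-- The relations of `𝓑_*^*(N, M)` say that `z` commutes with `δ` and that
`(x_1 ⋯ x_i)⁻¹ z x_1 ⋯ x_{i + M}` does not depend on `i ≤ N`. -/
theorem lift_rels_iff_prodTo {N M : ℕ} (hN : 0 < N) {f : JBraidGen N → H} {x : ℕ → H}
    (hx : ∀ l : Fin N, x l = f (.x l)) (hs : ∀ l, x (l + N) = f .y * x l * (f .y)⁻¹) :
    (∀ w ∈ rels N M, FreeGroup.lift f w = 1) ↔
      (prodTo x N * f .y * f .z = f .z * (prodTo x N * f .y) ∧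
        ∀ i < N, (prodTo x (i + 1))⁻¹ * f .z * prodTo x (i + 1 + M) =
          (prodTo x i)⁻¹ * f .z * prodTo x (i + M)) := by
  have hr : M % N < N := Nat.mod_lt _ hN
  have hqr : M / N * N + M % N = M := by rw [mul_comm]; exact Nat.div_add_mod M N
  set q := M / N with hq
  set r := M % N with hr'
  -- With `P_k = prodTo x k`, `x_{j+1} ⋯ x_N = P_j⁻¹ P_N`, and `z` commutes with `δ`, so `P_N y z
  -- δ^(q-1) = z δ^q`; then `z δ^q P_{j+r} = z P_{j+M} y^q` by `prodTo_mul_add`. The exponent `q -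
  -- 1` is an integer because `q` vanishes when `M < N`.
  have low : prodTo x N * f .y * f .z = f .z * (prodTo x N * f .y) → ∀ j, j + r ≤ N →
      FreeGroup.lift f (xTail N (j + 1) * wy N * wz N * delta N ^ ((q : ℤ) - 1) * xInit N (j + r)) =
        (prodTo x j)⁻¹ * f .z * prodTo x (j + M) * f .y ^ q := by
    intro hc j hj
    rw [show j + M = q * N + (j + r) by omega, prodTo_mul_add hs]
    simp only [map_mul, map_zpow, lift_delta hx, lift_xInit hx hj,
      lift_xTail hx (show j ≤ N by omega), wy, wz, FreeGroup.lift_apply_of]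
    generalize hδ : prodTo x N * f .y = δ at hc ⊢
    have : prodTo x N * f .y * f .z * δ ^ ((q : ℤ) - 1) = f .z * δ ^ q := by
      rw [hδ, hc, mul_assoc, ← zpow_one_add, add_sub_cancel, zpow_natCast]
    calc _ = (prodTo x j)⁻¹ * (prodTo x N * f .y * f .z * δ ^ ((q : ℤ) - 1)) *
          prodTo x (j + r) := by simp only [mul_assoc]
      _ = _ := by rw [this]; simp only [mul_assoc, inv_mul_cancel, mul_one]
  -- The index `j + r` has passed `N`, which costs one more factor `δ` and leaves `y^(q+1)`. In both
  -- ranges a relation compares two consecutive `j` with the same power of `y` on the right, so that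
  -- power cancels.
  have high : prodTo x N * f .y * f .z = f .z * (prodTo x N * f .y) → ∀ j, j ≤ N → N ≤ j + r →
      FreeGroup.lift f (xTail N (j + 1) * wy N * wz N * delta N ^ q * xInit N (j + r - N)) =
        (prodTo x j)⁻¹ * f .z * prodTo x (j + M) * f .y ^ (q + 1) := by
    intro hc j hj hj'
    rw [show j + M = (q + 1) * N + (j + r - N) by rw [add_mul]; omega, prodTo_mul_add hs]
    simp only [map_mul, map_pow, lift_delta hx, lift_xInit hx (show j + r - N ≤ N by omega),
      lift_xTail hx hj, wy, wz, FreeGroup.lift_apply_of]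
    generalize hδ : prodTo x N * f .y = δ at hc ⊢
    have : prodTo x N * f .y * f .z * δ ^ q = f .z * δ ^ (q + 1) := by
      rw [hδ, hc, mul_assoc, pow_succ']
    calc _ = (prodTo x j)⁻¹ * (prodTo x N * f .y * f .z * δ ^ q) *
          prodTo x (j + r - N) := by simp only [mul_assoc]
      _ = _ := by rw [this]; simp only [mul_assoc, inv_mul_cancel, mul_one]
  have first : FreeGroup.lift f ((xInit N N * wy N * wz N) * (wz N * xInit N N * wy N)⁻¹) = 1 ↔
      prodTo x N * f .y * f .z = f .z * (prodTo x N * f .y) := by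
    rw [map_mul, map_inv, mul_inv_eq_one]
    simp [lift_xInit hx le_rfl, wy, wz, mul_assoc]
  constructor
  · intro h
    have hc := first.1 (h _ (Or.inl (Or.inl rfl)))
    refine ⟨hc, fun i hi => ?_⟩
    rcases le_or_gt (i + 1 + r) N with hir | hir
    · have := h _ (Or.inl (Or.inr ⟨i + 1, by omega, by omega, rfl⟩))
      rw [map_mul, map_inv, mul_inv_eq_one, ← hq, ← hr', low hc _ hir,
        show i + 1 + r - 1 = i + r by omega, low hc _ (by omega)] at this
      exact mul_right_cancel this
    · have := h _ (Or.inr ⟨i + 1, by omega, by omega, rfl⟩)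
      rw [map_mul, map_inv, mul_inv_eq_one, ← hq, ← hr', high hc _ hi (by omega),
        show i + 1 + r - N - 1 = i + r - N by omega, high hc _ (by omega) (by omega)] at this
      exact mul_right_cancel this
  · rintro ⟨hc, h⟩ w ((rfl | ⟨i, hi, hi', rfl⟩) | ⟨i, hi, hi', rfl⟩)
    · exact first.2 hc
    · obtain ⟨i, rfl⟩ := Nat.exists_eq_add_of_le' hi
      rw [map_mul, map_inv, mul_inv_eq_one, ← hq, ← hr', low hc _ (by omega),
        show i + 1 + r - 1 = i + r by omega, low hc _ (by omega), h i (by omega)]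
    · obtain ⟨i, rfl⟩ := Nat.exists_eq_add_of_le' (show 1 ≤ i by omega)
      rw [map_mul, map_inv, mul_inv_eq_one, ← hq, ← hr', high hc _ hi' (by omega),
        show i + 1 + r - N - 1 = i + r - N by omega, high hc _ (by omega) (by omega),
        h i (by omega)]

/-- A quantity `P_i⁻¹ z P_{i+M}` independent of `i` equals its value `W = z P_M` at `i = 0`, and
comparing `i` with `i + 1` gives `x_i W = W x_{i+M}`. This holds first for `i < N`; commutation of
`y` with `W` carries it to all indices. -/
theorem lift_rels_iff {N M : ℕ} (hN : 0 < N) {f : JBraidGen N → H} {x : ℕ → H}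
    (hx : ∀ l : Fin N, x l = f (.x l)) (hs : ∀ l, x (l + N) = f .y * x l * (f .y)⁻¹) :
    (∀ w ∈ rels N M, FreeGroup.lift f w = 1) ↔ SeqRelations N M x (f .y) (f .z) := by
  rw [lift_rels_iff_prodTo hN hx hs]
  generalize f .y = y at *
  generalize f .z = z at *
  have hNM : prodTo x (N + M) = prodTo x N * y * prodTo x M * y⁻¹ := by
    rw [prodTo_add]
    simp only [hs, prodTo_conj]
    group
  constructor
  · rintro ⟨hc, h⟩
    have hW : ∀ i ≤ N, (prodTo x i)⁻¹ * z * prodTo x (i + M) = z * prodTo x M := by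
      intro i hi
      induction i with
      | zero => simp [prodTo_zero]
      | succ i ih => rw [h i hi, ih (by omega)]
    -- Case `i = N`: since `P_{N+M} = P_N y P_M y⁻¹` and `z` commutes with `P_N y`, it reads `y W
    -- y⁻¹ = W`.
    have hy : y * (z * prodTo x M) = z * prodTo x M * y := by
      have h1 : (prodTo x N)⁻¹ * z * (prodTo x N * y * prodTo x M * y⁻¹) =
          (prodTo x N)⁻¹ * (z * (prodTo x N * y)) * prodTo x M * y⁻¹ := by group
      have h2 := hW N le_rfl
      rw [hNM, h1, ← hc] at h2
      calc _ = (prodTo x N)⁻¹ * (prodTo x N * y * z) * prodTo x M * y⁻¹ * y := by group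
        _ = _ := by rw [h2]
    have hx' : ∀ l < N, x l * (z * prodTo x M) = z * prodTo x M * x (l + M) := by
      intro l hl
      have h1 := hW (l + 1) hl
      rw [add_right_comm, prodTo_succ, prodTo_succ] at h1
      have h2 : (prodTo x l * x l)⁻¹ * z * (prodTo x (l + M) * x (l + M)) =
        (x l)⁻¹ * ((prodTo x l)⁻¹ * z * prodTo x (l + M)) * x (l + M) := by group
      rw [h2, hW l hl.le] at h1
      rw [← eq_inv_mul_iff_mul_eq, ← mul_assoc, h1]
    refine ⟨hs, fun l => ?_, hy⟩
    generalize z * prodTo x M = W at *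
    induction l using Nat.strong_induction_on with
    | _ l ih =>
      rcases lt_or_ge l N with hl | hl
      · exact hx' l hl
      · obtain ⟨l, rfl⟩ := Nat.exists_eq_add_of_le' hl
        have hy' : y⁻¹ * W = W * y⁻¹ := (Commute.inv_left (show Commute y W from hy)).eq
        rw [add_right_comm, hs, hs, mul_assoc (y * x l), hy', ← mul_assoc, mul_assoc y,
          ih l (by omega), ← mul_assoc, ← mul_assoc, hy]
        simp only [mul_assoc]
  · rintro ⟨-, h, hy⟩
    have hW : ∀ i, (prodTo x i)⁻¹ * z * prodTo x (i + M) = z * prodTo x M := by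
      intro i
      induction i with
      | zero => simp [prodTo_zero]
      | succ i ih =>
        have h1 : (prodTo x i * x i)⁻¹ * z * (prodTo x (i + M) * x (i + M)) =
          (x i)⁻¹ * (((prodTo x i)⁻¹ * z * prodTo x (i + M)) * x (i + M)) := by group
        rw [add_right_comm, prodTo_succ, prodTo_succ, h1, ih, ← h, inv_mul_cancel_left]
    refine ⟨?_, fun i _ => by rw [hW, hW]⟩
    have h1 := hW N
    rw [hNM, ← mul_inv_eq_iff_eq_mul.2 hy] at h1
    have h2 := congrArg (fun g => prodTo x N * g * y * (prodTo x M)⁻¹) h1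
    simpa [mul_assoc] using h2.symm

end JBraid

/-! ### Torsion relations -/

/-- `a ^ e = 1`, a condition which is void for `e = ∞`. -/
def PowEqOne {G : Type*} [Group G] (a : G) (e : ℕ∞) : Prop :=
  ∀ k : ℕ, e = k → a ^ k = 1

section PowEqOne

variable {G H : Type*} [Group G] [Group H]

theorem PowEqOne.map {a : G} {e : ℕ∞} (h : PowEqOne a e) (φ : G →* H) : PowEqOne (φ a) e :=
  fun k hk => by rw [← map_pow, h k hk, map_one]

theorem PowEqOne.conj {a : G} {e : ℕ∞} (h : PowEqOne a e) (g : G) : PowEqOne (g * a * g⁻¹) e :=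
  h.map (MulAut.conj g).toMonoidHom

theorem PowEqOne.of_isConj {a a' : G} {e : ℕ∞} (h : PowEqOne a e) (haa' : IsConj a a') :
    PowEqOne a' e := by
  obtain ⟨g, rfl⟩ := isConj_iff.1 haa'
  exact h.conj g

theorem powEqOne_one_right {a : G} : PowEqOne a 1 ↔ a = 1 :=
  ⟨fun h => by simpa using h 1 rfl, fun h k _ => by simp [h]⟩

/-- The relation `a ^ (e n) = 1` says that `(a ^ n) ^ e = 1`. -/
theorem powEqOne_mul_iff {a : G} {e : ℕ∞} {n : ℕ} (hn : 0 < n) :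
    PowEqOne a (e * n) ↔ PowEqOne (a ^ n) e := by
  constructor
  · rintro h k rfl
    rw [← pow_mul, mul_comm]
    exact h _ (by simp)
  · intro h k hk
    cases e with
    | top => rw [ENat.top_mul (by simpa using hn.ne')] at hk; simp at hk
    | coe e =>
      have : e * n = k := by exact_mod_cast hk
      rw [← this, mul_comm, pow_mul, h e rfl]

end PowEqOne

/-! ### Cyclic extensions -/

/-- If `α` is an endomorphism of `G` fixing `y` and `α ^ n` is the conjugation by `y`, then `G`
embeds in a group generated by `G` and an element `t` which acts on `G` as `α` and satisfies
`t ^ n = y`. -/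
theorem exists_cyclic_extension {G : Type} [Group G] {n : ℕ} (hn : 0 < n) (α : G →* G) (y : G)
    (hy : α y = y) (hα : ∀ g, α^[n] g = y * g * y⁻¹) :
    ∃ (E : Type) (_ : Group E) (ι : G →* E) (t : E), Function.Injective ι ∧ t ^ n = ι y ∧
      (∀ g, t * ι g * t⁻¹ = ι (α g)) ∧ ∀ e, ∃ (g : G) (k : ℤ), e = ι g * t ^ k := by
  -- `α^n` is an inner automorphism and factors through `α` on either side.
  have hbij : Function.Bijective α := by
    have h : Function.Bijective α^[n] := by
      rw [funext hα]
      exact (MulAut.conj y).bijective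
    obtain ⟨n, rfl⟩ := Nat.exists_eq_add_of_le' hn
    have h' := h
    rw [Function.iterate_succ] at h
    rw [Function.iterate_succ'] at h'
    exact ⟨h.1.of_comp, h'.2.of_comp⟩
  let a : MulAut G := MulEquiv.ofBijective α hbij
  have ha : ∀ g, a g = α g := fun _ => rfl
  have hapow : ∀ g, (a ^ n) g = y * g * y⁻¹ := by
    intro g
    rw [← hα]
    clear hα hn
    induction n generalizing g with
    | zero => rfl
    | succ n ih => rw [pow_succ, MulAut.mul_apply, ih, Function.iterate_succ_apply, ha]
  let S := G ⋊[zpowersHom (MulAut G) a] Multiplicative ℤ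
  let τ : S := SemidirectProduct.inr (Multiplicative.ofAdd 1)
  have hτ : ∀ g, τ * SemidirectProduct.inl g * τ⁻¹ = SemidirectProduct.inl (α g) := by
    intro g
    have := SemidirectProduct.inl_aut (φ := zpowersHom (MulAut G) a) (Multiplicative.ofAdd 1) g
    rw [← ha, map_inv] at *
    simpa using this.symm
  have hgen : ∀ e : S, ∃ (g : G) (k : ℤ), e = SemidirectProduct.inl g * τ ^ k := by
    intro e
    refine ⟨e.left, e.right.toAdd, ?_⟩
    rw [← map_zpow, ← ofAdd_zsmul, zsmul_one]
    exact (SemidirectProduct.inl_left_mul_inr_right e).symm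
  -- In `G ⋊ ℤ` the elements `τ^n` and `y` act alike on `G`, and `τ` fixes `y`, so `c` is central;
  -- the extension is the quotient that identifies `τ^n` with `y`.
  let c : S := SemidirectProduct.inl y⁻¹ * τ ^ n
  have hcτ : Commute c τ := by
    refine Commute.mul_left ?_ (Commute.pow_self τ n)
    refine (mul_inv_eq_iff_eq_mul.1 ?_ : _ = _).symm
    rw [hτ, map_inv, hy]
  have hcG : ∀ g, Commute c (SemidirectProduct.inl g) := by
    intro g
    have h1 : ∀ k g, τ ^ k * SemidirectProduct.inl g = SemidirectProduct.inl ((a ^ k) g) * τ ^ k := by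
      intro k
      induction k with
      | zero => simp
      | succ k ih =>
        intro g
        rw [pow_succ, mul_assoc, mul_inv_eq_iff_eq_mul.1 (hτ g), ← mul_assoc, ih, pow_succ,
          MulAut.mul_apply, ha, mul_assoc]
    change _ * _ = _ * _
    rw [mul_assoc, h1, hapow, ← mul_assoc, ← map_mul, ← mul_assoc (SemidirectProduct.inl g),
      ← map_mul]
    congr 2
    group
  have hc : ∀ e, Commute c e := by
    intro e
    obtain ⟨g, k, rfl⟩ := hgen e
    exact (hcG g).mul_right (hcτ.zpow_right k)
  have : (Subgroup.zpowers c).Normal := ⟨by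
    rintro _ ⟨k, rfl⟩ g
    refine ⟨k, ?_⟩
    rw [(((hc g).zpow_left k).symm).eq, mul_inv_cancel_right]⟩
  refine ⟨S ⧸ Subgroup.zpowers c, inferInstance, (QuotientGroup.mk' _).comp SemidirectProduct.inl,
    QuotientGroup.mk' _ τ, ?_, ?_, ?_, ?_⟩
  · rw [injective_iff_map_eq_one]
    intro g hg
    obtain ⟨k, hk⟩ := (QuotientGroup.eq_one_iff _).1 hg
    -- The projection to `ℤ` sends `c` to `n ≠ 0`, so no nontrivial power of `c` lies in `G`.
    have h1 : SemidirectProduct.rightHom c = Multiplicative.ofAdd (n : ℤ) := by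
      rw [map_mul, map_pow, SemidirectProduct.rightHom_inl, SemidirectProduct.rightHom_inr,
        one_mul, ← ofAdd_nsmul, nsmul_one]
    have h2 : k = 0 := by
      have h2 : SemidirectProduct.rightHom (c ^ k) = 1 := by
        rw [show c ^ k = _ from hk, SemidirectProduct.rightHom_inl]
      rw [map_zpow, h1, ← ofAdd_zsmul, ofAdd_eq_one] at h2
      simpa [hn.ne'] using h2
    apply SemidirectProduct.inl_injective (φ := zpowersHom (MulAut G) a)
    rw [map_one, ← hk, h2]
    simp
  · rw [← map_pow, MonoidHom.comp_apply]
    refine QuotientGroup.eq.2 (Subgroup.mem_zpowers_iff.2 ⟨-1, ?_⟩)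
    simp only [c, zpow_neg_one, mul_inv_rev, map_inv]
    exact congrArg (_ * ·) (inv_inv _)
  · intro g
    rw [MonoidHom.comp_apply, MonoidHom.comp_apply, ← hτ]
    simp
  · intro e
    obtain ⟨e, rfl⟩ := QuotientGroup.mk'_surjective _ e
    obtain ⟨g, k, rfl⟩ := hgen e
    exact ⟨g, k, by simp⟩

/-! ### Morphisms from parent `J`-groups -/

theorem List.prod_rotate_of_commute {H : Type*} [Group H] {L : List H}
    (h : ∀ a ∈ L, Commute a L.prod) {i : ℕ} (hi : i ≤ L.length) :
    (L.rotate i).prod = L.prod := by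
  have hc : Commute (L.take i).prod L.prod :=
    Commute.list_prod_left _ _ fun a ha => h a (List.mem_of_mem_take ha)
  rw [List.rotate_eq_drop_append_take hi, List.prod_append]
  refine mul_left_cancel (a := (L.take i).prod) ?_
  rw [← mul_assoc, List.prod_take_mul_prod_drop, hc.eq]

/-- Equality of a rotation with the whole product says that the prefix moved to the end commutes
with the product; a letter is the quotient of two consecutive prefixes. -/
theorem List.commute_prod_of_rotate {H : Type*} [Group H] {L : List H}
    (h : ∀ i < L.length, (L.rotate i).prod = L.prod) {a : H} (ha : a ∈ L) : Commute a L.prod := by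
  have hc : ∀ i ≤ L.length, Commute (L.take i).prod L.prod := by
    intro i hi
    have h1 : (L.rotate i).prod = L.prod := by
      rcases hi.lt_or_eq with hi | rfl
      · exact h i hi
      · rw [List.rotate_length]
    rw [List.rotate_eq_drop_append_take hi, List.prod_append] at h1
    change _ * _ = _ * _
    nth_rw 1 [← h1]
    rw [← mul_assoc, List.prod_take_mul_prod_drop]
  obtain ⟨i, hi, rfl⟩ := List.getElem_of_mem ha
  have h1 := hc (i + 1) hi
  rw [List.prod_take_succ _ _ hi] at h1
  have h2 := (hc i hi.le).inv_left.mul_left h1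
  rwa [inv_mul_cancel_left] at h2

namespace JGroup

variable {p : ℕ}

theorem commute_prod (K : Fin p → ℕ∞) (i : Fin p) :
    Commute (s K i) (List.ofFn (s K)).prod := by
  refine List.commute_prod_of_rotate (fun j hj => ?_) (List.mem_ofFn.2 ⟨i, rfl⟩)
  have := PresentedGroup.one_of_mem (rels := JGroupRels K)
    (Or.inl ⟨j, by simpa using hj, rfl⟩)
  rw [map_mul, map_inv, mul_inv_eq_one, map_list_prod, map_list_prod, List.map_rotate,
    List.map_ofFn] at this
  exact this

theorem closure_range_s (K : Fin p → ℕ∞) : Subgroup.closure (Set.range (s K)) = ⊤ :=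
  PresentedGroup.closure_range_of _

theorem commute_ofFn_prod (K : Fin p → ℕ∞) (g : JGroup K) :
    Commute g (List.ofFn (s K)).prod := by
  have h : Subgroup.closure (Set.range (s K)) ≤
      Subgroup.centralizer {(List.ofFn (s K)).prod} := by
    rw [Subgroup.closure_le]
    rintro _ ⟨i, rfl⟩
    refine Subgroup.mem_centralizer_iff.2 ?_
    rintro _ rfl
    exact (commute_prod K i).eq.symm
  rw [closure_range_s] at h
  exact (Subgroup.mem_centralizer_iff.1 (h (Subgroup.mem_top g)) _ rfl).symm

theorem powEqOne_s (K : Fin p → ℕ∞) (i : Fin p) : PowEqOne (s K i) (K i) :=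
  fun k hk => s_pow_eq_one K i k (by rw [hk])

/-- Centrality of the product replaces the cyclic relations, a form which can be checked without
rotating lists. -/
theorem exists_lift {H : Type*} [Group H] (K : Fin p → ℕ∞) (f : Fin p → H)
    (hf : ∀ i, Commute (f i) (List.ofFn f).prod) (hK : ∀ i, PowEqOne (f i) (K i)) :
    ∃ ψ : JGroup K →* H, ∀ i, ψ (s K i) = f i := by
  refine ⟨PresentedGroup.toGroup (f := f) ?_, fun i => PresentedGroup.toGroup.of _⟩
  rintro w (⟨i, hi, rfl⟩ | ⟨i, k, hk, rfl⟩)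
  · have h : (FreeGroup.lift f) ∘ (fun j : Fin p => FreeGroup.of j) = f := by ext; simp
    rw [map_mul, map_inv, mul_inv_eq_one, map_list_prod, map_list_prod, List.map_rotate,
      List.map_ofFn, h]
    refine List.prod_rotate_of_commute ?_ (by simpa using hi.le)
    intro a ha
    obtain ⟨j, rfl⟩ := List.mem_ofFn.1 ha
    exact hf j
  · simpa using hK i k hk

theorem ofFn_extTuple_prod {H : Type*} [Group H] (f : Fin p → H) (t u : H) :
    (List.ofFn (extTuple f t u)).prod = (List.ofFn f).prod * t * u := by
  rw [extTuple, List.ofFn_fin_append]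
  simp [mul_assoc]

end JGroup

/-! ### The universal property of torsion quotients -/

namespace JBraid

/-- The relations of `𝓑_*^*(N, M; K, b, c)`, for elements of a group `H`. -/
structure TorsionRelations {N M : ℕ} (K : Fin (Nat.gcd N M) → ℕ∞) (b c : ℕ∞) {H : Type*} [Group H]
    (f : JBraidGen N → H) : Prop where
  rels : ∀ w ∈ rels N M, FreeGroup.lift f w = 1
  x : ∀ (i : Fin (Nat.gcd N M)) (l : Fin N), (l : ℕ) = i → PowEqOne (f (.x l)) (K i)
  y : PowEqOne (f .y) b
  z : PowEqOne (f .z) c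

/-- `G` with the generators `gen` is the group `𝓑_*^*(N, M; K, b, c)`. The exponents `b = 1` and
`c = 1` give the quotients by `y` and by `z`. -/
structure IsTorsionQuotient {N M : ℕ} (K : Fin (Nat.gcd N M) → ℕ∞) (b c : ℕ∞) {G : Type} [Group G]
    (gen : JBraidGen N → G) : Prop where
  relations : TorsionRelations K b c gen
  closure_range : Subgroup.closure (Set.range gen) = ⊤
  exists_lift : ∀ (H : Type) [Group H] (f : JBraidGen N → H), TorsionRelations K b c f →
    ∃ φ : G →* H, ∀ a, φ (gen a) = f a

/-- The nontrivial powers of the conjugates of the elements `gen a`. -/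
def genReflections {ι G : Type*} [Group G] (gen : ι → G) : Set G :=
  {r | r ≠ 1 ∧ ∃ (a : ι) (h : G) (e : ℤ), r = (h * gen a * h⁻¹) ^ e}

/-- A generator killed in `B` contributes only trivial powers, so all of `x_i`, `y`, `z` may be kept
in each of the four families. -/
theorem quotientReflections_eq {ι B : Type*} [Group B] {gen : ι → B} {S : Set B} (N : Subgroup B)
    [N.Normal] (hS : S ⊆ Set.range gen) (hS' : ∀ a, gen a ∈ S ∨ gen a = 1) :
    quotientReflections S N = genReflections fun a => (gen a : B ⧸ N) := by
  ext r
  refine and_congr_right fun hr => ⟨?_, ?_⟩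
  · rintro ⟨β, hβ, h, e, rfl⟩
    obtain ⟨s, hs, hc⟩ := Group.mem_conjugatesOfSet_iff.1 hβ
    obtain ⟨g, rfl⟩ := isConj_iff.1 hc
    obtain ⟨a, rfl⟩ := hS hs
    refine ⟨a, h * (g : B), e, ?_⟩
    simp [mul_assoc]
  · rintro ⟨a, h, e, rfl⟩
    rcases hS' a with ha | ha
    · exact ⟨gen a, Group.subset_conjugatesOfSet ha, h, e, rfl⟩
    · simp [ha] at hr

theorem closure_range_mk {ι B : Type*} [Group B] {gen : ι → B} (N : Subgroup B) [N.Normal]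
    (h : Subgroup.closure (Set.range gen) = ⊤) :
    Subgroup.closure (Set.range fun a => (gen a : B ⧸ N)) = ⊤ := by
  have h1 : (Set.range fun a => (gen a : B ⧸ N)) = QuotientGroup.mk' N '' Set.range gen := by
    rw [← Set.range_comp]
    rfl
  rw [h1, ← MonoidHom.map_closure, h, ← MonoidHom.range_eq_map,
    MonoidHom.range_eq_top.2 (QuotientGroup.mk'_surjective N)]

theorem exists_lift_mk {B H : Type*} [Group B] [Group H] (S : Set B) (φ : B →* H)
    (h : ∀ s ∈ S, φ s = 1) :
    ∃ ψ : B ⧸ Subgroup.normalClosure S →* H, ∀ g : B, ψ g = φ g :=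
  ⟨QuotientGroup.lift _ φ (fun _ hg => (Subgroup.normalClosure_le_normal (N := φ.ker) h) hg),
    fun _ => rfl⟩

theorem mk_eq_one {B : Type*} [Group B] {S : Set B} {s : B} (h : s ∈ S) :
    (s : B ⧸ Subgroup.normalClosure S) = 1 :=
  (QuotientGroup.eq_one_iff _).2 (Subgroup.subset_normalClosure h)

theorem lift_mk {ι B : Type*} [Group B] (N : Subgroup B) [N.Normal] (gen : ι → B)
    (w : FreeGroup ι) :
    FreeGroup.lift (fun a => (gen a : B ⧸ N)) w = (FreeGroup.lift gen w : B) := by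
  have : FreeGroup.lift (fun a => (gen a : B ⧸ N)) =
      (QuotientGroup.mk' N).comp (FreeGroup.lift gen) := by
    ext a
    simp
  rw [this]
  rfl

theorem powEqOne_mk {B : Type*} [Group B] {S : Set B} {a : B} {e : ℕ∞}
    (h : torsionRelator a e ⊆ S) : PowEqOne (a : B ⧸ Subgroup.normalClosure S) e :=
  fun k hk => mk_eq_one (h ⟨k, hk, rfl⟩)

theorem hom_ext_of_closure {ι G H : Type*} [Group G] [Group H] {gen : ι → G}
    (hgen : Subgroup.closure (Set.range gen) = ⊤) {φ ψ : G →* H}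
    (h : ∀ a, φ (gen a) = ψ (gen a)) : φ = ψ :=
  MonoidHom.eq_of_eqOn_dense hgen (by rintro _ ⟨a, rfl⟩; exact h a)

variable {N M : ℕ} (K : Fin (Nat.gcd N M) → ℕ∞) (b c : ℕ∞)

theorem Both.closure_range_gen : Subgroup.closure (Set.range (Both.gen (n := N) (m := M))) = ⊤ :=
  PresentedGroup.closure_range_of _

theorem Both.lift_gen (w : FreeGroup (JBraidGen N)) :
    FreeGroup.lift (Both.gen (m := M)) w = PresentedGroup.mk _ w :=
  DFunLike.congr_fun (f := FreeGroup.lift (Both.gen (m := M))) (g := PresentedGroup.mk _)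
    (by ext; simp [Both.gen, PresentedGroup.of]) w

theorem Both.lift_rels {w : FreeGroup (JBraidGen N)} (hw : w ∈ JBraid.rels N M) :
    FreeGroup.lift (Both.gen (m := M)) w = 1 := by
  rw [Both.lift_gen]
  exact PresentedGroup.one_of_mem hw

theorem TBoth.isTorsionQuotient : IsTorsionQuotient K b c (TBoth.gen K b c) where
  relations :=
    { rels := fun w hw => by
        refine (lift_mk (torsionBoth N M K b c) Both.gen w).trans ?_
        rw [Both.lift_rels hw, QuotientGroup.mk_one]
      x := fun i l hil => powEqOne_mk fun w hw => Or.inl (Or.inl ⟨i, l, hil, hw⟩)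
      y := powEqOne_mk fun w hw => Or.inl (Or.inr hw)
      z := powEqOne_mk fun w hw => Or.inr hw }
  closure_range := closure_range_mk _ Both.closure_range_gen
  exists_lift := fun H _ f hf => by
    obtain ⟨φ, hφ⟩ := exists_lift_mk
      (xTorsion Both.gen K ∪ torsionRelator (Both.gen .y) b ∪ torsionRelator (Both.gen .z) c)
      (PresentedGroup.toGroup hf.rels) (by
        rintro w ((⟨i, l, hl, k, hk, rfl⟩ | ⟨k, hk, rfl⟩) | ⟨k, hk, rfl⟩)
        · simpa [Both.gen] using hf.x i l hl k hk
        · simpa [Both.gen] using hf.y k hk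
        · simpa [Both.gen] using hf.z k hk)
    exact ⟨φ, fun a => (hφ _).trans (by simp [Both.gen])⟩

theorem TUp.isTorsionQuotient : IsTorsionQuotient K 1 c (TUp.gen K c) where
  relations :=
    { rels := fun w hw => by
        refine (lift_mk (torsionUp N M K c) Up.gen w).trans ?_
        refine (congrArg _ (lift_mk _ Both.gen w)).trans ?_
        rw [Both.lift_rels hw, QuotientGroup.mk_one, QuotientGroup.mk_one]
      x := fun i l hil => powEqOne_mk fun w hw => Or.inl ⟨i, l, hil, hw⟩
      y := by
        have : (Up.gen .y : Up N M) = 1 := mk_eq_one rfl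
        simp [TUp.gen, this, powEqOne_one_right]
      z := powEqOne_mk fun w hw => Or.inr hw }
  closure_range := closure_range_mk _ (closure_range_mk _ Both.closure_range_gen)
  exists_lift := fun H _ f hf => by
    obtain ⟨φ, hφ⟩ := exists_lift_mk {(Both.gen .y : Both N M)} (PresentedGroup.toGroup hf.rels) (by
      rintro _ rfl
      simpa [Both.gen] using powEqOne_one_right.1 hf.y)
    replace hφ : ∀ a, φ (Up.gen a) = f a := fun a => (hφ _).trans (by simp [Both.gen])
    obtain ⟨φ', hφ'⟩ := exists_lift_mk (xTorsion Up.gen K ∪ torsionRelator (Up.gen .z) c) φ (by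
      rintro w (⟨i, l, hl, k, hk, rfl⟩ | ⟨k, hk, rfl⟩)
      · simpa only [map_pow, hφ] using hf.x i l hl k hk
      · simpa only [map_pow, hφ] using hf.z k hk)
    exact ⟨φ', fun a => (hφ' _).trans (hφ a)⟩

theorem TLow.isTorsionQuotient : IsTorsionQuotient K b 1 (TLow.gen K b) where
  relations :=
    { rels := fun w hw => by
        refine (lift_mk (torsionLow N M K b) Low.gen w).trans ?_
        refine (congrArg _ (lift_mk _ Both.gen w)).trans ?_
        rw [Both.lift_rels hw, QuotientGroup.mk_one, QuotientGroup.mk_one]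
      x := fun i l hil => powEqOne_mk fun w hw => Or.inl ⟨i, l, hil, hw⟩
      y := powEqOne_mk fun w hw => Or.inr hw
      z := by
        have : (Low.gen .z : Low N M) = 1 := mk_eq_one rfl
        simp [TLow.gen, this, powEqOne_one_right] }
  closure_range := closure_range_mk _ (closure_range_mk _ Both.closure_range_gen)
  exists_lift := fun H _ f hf => by
    obtain ⟨φ, hφ⟩ := exists_lift_mk {(Both.gen .z : Both N M)} (PresentedGroup.toGroup hf.rels) (by
      rintro _ rfl
      simpa [Both.gen] using powEqOne_one_right.1 hf.z)
    replace hφ : ∀ a, φ (Low.gen a) = f a := fun a => (hφ _).trans (by simp [Both.gen])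
    obtain ⟨φ', hφ'⟩ := exists_lift_mk (xTorsion Low.gen K ∪ torsionRelator (Low.gen .y) b) φ (by
      rintro w (⟨i, l, hl, k, hk, rfl⟩ | ⟨k, hk, rfl⟩)
      · simpa only [map_pow, hφ] using hf.x i l hl k hk
      · simpa only [map_pow, hφ] using hf.y k hk)
    exact ⟨φ', fun a => (hφ' _).trans (hφ a)⟩

theorem TCirc.isTorsionQuotient : IsTorsionQuotient K 1 1 (TCirc.gen K) where
  relations :=
    { rels := fun w hw => by
        refine (lift_mk (torsionCirc N M K) Circ.gen w).trans ?_
        refine (congrArg _ (lift_mk _ Both.gen w)).trans ?_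
        rw [Both.lift_rels hw, QuotientGroup.mk_one, QuotientGroup.mk_one]
      x := fun i l hil => powEqOne_mk fun w hw => ⟨i, l, hil, hw⟩
      y := by
        have : (Circ.gen .y : Circ N M) = 1 := mk_eq_one (Or.inl rfl)
        simp [TCirc.gen, this, powEqOne_one_right]
      z := by
        have : (Circ.gen .z : Circ N M) = 1 := mk_eq_one (Or.inr rfl)
        simp [TCirc.gen, this, powEqOne_one_right] }
  closure_range := closure_range_mk _ (closure_range_mk _ Both.closure_range_gen)
  exists_lift := fun H _ f hf => by
    obtain ⟨φ, hφ⟩ := exists_lift_mk {(Both.gen .y : Both N M), (Both.gen .z : Both N M)}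
      (PresentedGroup.toGroup hf.rels) (by
        rintro _ (rfl | rfl)
        · simpa [Both.gen] using powEqOne_one_right.1 hf.y
        · simpa [Both.gen] using powEqOne_one_right.1 hf.z)
    replace hφ : ∀ a, φ (Circ.gen a) = f a := fun a => (hφ _).trans (by simp [Both.gen])
    obtain ⟨φ', hφ'⟩ := exists_lift_mk (xTorsion Circ.gen K) φ (by
      rintro w ⟨i, l, hl, k, hk, rfl⟩
      simpa only [map_pow, hφ] using hf.x i l hl k hk)
    exact ⟨φ', fun a => (hφ' _).trans (hφ a)⟩

theorem TBoth.reflections_eq : TBoth.reflections N M K b c = genReflections (TBoth.gen K b c) :=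
  quotientReflections_eq _ subset_rfl fun a => Or.inl ⟨a, rfl⟩

theorem TUp.reflections_eq : TUp.reflections N M K c = genReflections (TUp.gen K c) := by
  refine quotientReflections_eq (gen := Up.gen) _ ?_ ?_
  · rintro _ (⟨i, rfl⟩ | rfl)
    exacts [⟨_, rfl⟩, ⟨_, rfl⟩]
  · rintro (i | _ | _)
    exacts [Or.inl (Or.inl ⟨i, rfl⟩), Or.inr (mk_eq_one rfl), Or.inl (Or.inr rfl)]

theorem TLow.reflections_eq : TLow.reflections N M K b = genReflections (TLow.gen K b) := by
  refine quotientReflections_eq (gen := Low.gen) _ ?_ ?_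
  · rintro _ (⟨i, rfl⟩ | rfl)
    exacts [⟨_, rfl⟩, ⟨_, rfl⟩]
  · rintro (i | _ | _)
    exacts [Or.inl (Or.inl ⟨i, rfl⟩), Or.inl (Or.inr rfl), Or.inr (mk_eq_one rfl)]

theorem TCirc.reflections_eq : TCirc.reflections N M K = genReflections (TCirc.gen K) := by
  refine quotientReflections_eq (gen := Circ.gen) _ ?_ ?_
  · rintro _ ⟨i, rfl⟩
    exact ⟨_, rfl⟩
  · rintro (i | _ | _)
    exacts [Or.inl ⟨i, rfl⟩, Or.inr (mk_eq_one (Or.inl rfl)), Or.inr (mk_eq_one (Or.inr rfl))]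

end JBraid

/-! ### Translation of the relations by `p`, and adjunction of roots of `y` and `z`. -/

namespace JBraid

section Sequences

variable {H H' : Type*} [Group H] [Group H']

theorem conj_periodic_mul_add {x : ℕ → H} {t : H} {p : ℕ} (hs : ∀ l, x (l + p) = t * x l * t⁻¹)
    (q l : ℕ) : x (l + p * q) = t ^ q * x l * (t ^ q)⁻¹ := by
  induction q with
  | zero => simp
  | succ q ih =>
    rw [Nat.mul_succ, ← add_assoc, hs, ih, pow_succ']
    group

theorem map_conj_periodic {N : ℕ} (hN : 0 < N) {x : ℕ → H} {x' : ℕ → H'} {y : H} {y' : H'}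
    (hs : ∀ l, x (l + N) = y * x l * y⁻¹) (hs' : ∀ l, x' (l + N) = y' * x' l * y'⁻¹)
    (φ : H →* H') (hy : φ y = y') (hx : ∀ l < N, φ (x l) = x' l) (l : ℕ) : φ (x l) = x' l := by
  have hl : l % N + N * (l / N) = l := Nat.mod_add_div l N
  rw [← hl, conj_periodic_mul_add hs, conj_periodic_mul_add hs']
  simp [hy, hx _ (Nat.mod_lt l hN)]

/-- Conjugation by `y` translates by `N` and conjugation by `(z P_M)⁻¹` translates by `M`; the
Chinese remainder theorem joins two indices congruent modulo the gcd through a third one. This is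
why torsion need only be imposed on the first `gcd(N, M)` generators. -/
theorem SeqRelations.isConj {N M : ℕ} {x : ℕ → H} {y z : H} (h : SeqRelations N M x y z)
    {l l' : ℕ} (hl : l ≡ l' [MOD Nat.gcd N M]) : IsConj (x l) (x l') := by
  have h1 : ∀ l l', l ≡ l' [MOD N] → IsConj (x l) (x l') := by
    have h2 : ∀ l, IsConj (x (l % N)) (x l) := by
      intro l
      refine isConj_iff.2 ⟨y ^ (l / N), ?_⟩
      rw [← conj_periodic_mul_add h.shift, Nat.mod_add_div]
    intro l l' hl
    refine (h2 l).symm.trans ?_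
    rw [show l % N = l' % N from hl]
    exact h2 l'
  have h1' : ∀ l l', l ≡ l' [MOD M] → IsConj (x l) (x l') := by
    have h2 : ∀ l, IsConj (x (l % M)) (x l) := by
      intro l
      refine isConj_iff.2 ⟨(z * prodTo x M)⁻¹ ^ (l / M), ?_⟩
      rw [← conj_periodic_mul_add (fun l => ?_), Nat.mod_add_div]
      rw [inv_inv, mul_assoc, h.x_comm, inv_mul_cancel_left]
    intro l l' hl
    refine (h2 l).symm.trans ?_
    rw [show l % M = l' % M from hl]
    exact h2 l'
  obtain ⟨k, hk, hk'⟩ := Nat.chineseRemainder' hl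
  exact (h1 _ _ hk).symm.trans (h1' _ _ hk')

/-- The element `W = z P_M` is invariant under translation: regrouping `P_{p+M}` turns the left side
into `P_p⁻¹ W (x_M ⋯ x_{M+p-1})`, and `W` moves past `P_p`. -/
theorem SeqRelations.conj_eq {N M : ℕ} {x : ℕ → H} {y z : H} (h : SeqRelations N M x y z) (p : ℕ) :
    (prodTo x p)⁻¹ * z * prodTo x p * prodTo (fun l => x (l + p)) M = z * prodTo x M := by
  have h1 : prodTo x p * prodTo (fun l => x (l + p)) M =
      prodTo x M * prodTo (fun l => x (l + M)) p := by
    rw [← prodTo_add, ← prodTo_add, add_comm]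
  rw [mul_assoc, h1, mul_assoc, ← mul_assoc z, ← prodTo_semiconj h.x_comm, inv_mul_cancel_left]

/-- The relations of `𝓑_*^*(N, M)` are preserved by `x_l ↦ x_{l + p}`, `y ↦ y`,
`z ↦ (x_1 ⋯ x_p)⁻¹ z x_1 ⋯ x_p`. -/
theorem SeqRelations.translate {N M : ℕ} {x : ℕ → H} {y z : H} (h : SeqRelations N M x y z)
    (p : ℕ) : SeqRelations N M (fun l => x (l + p)) y ((prodTo x p)⁻¹ * z * prodTo x p) where
  shift l := by rw [add_right_comm, h.shift]
  x_comm l := by rw [h.conj_eq, h.x_comm, add_right_comm]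
  y_comm := by rw [h.conj_eq, h.y_comm]

/-- `u` is the quotient of `P_p t u` by `P_p t`, and both commute with `P_p t`. -/
theorem commute_of_central {x : ℕ → H} {t u : H} {p : ℕ}
    (hx : ∀ l, Commute (x l) (prodTo x p * t * u)) (ht : Commute t (prodTo x p * t * u)) :
    Commute u (prodTo x p * t) := by
  have h1 : ∀ k, Commute (prodTo x k) (prodTo x p * t * u) := by
    intro k
    induction k with
    | zero => exact Commute.one_left _
    | succ k ih => exact ih.mul_left (hx k)
  have h2 := (h1 p).mul_left ht
  have h3 := (Commute.refl (prodTo x p * t)).inv_left.mul_left h2.symm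
  rwa [inv_mul_cancel_left] at h3

/-- As `P_{pm} = (P_p t)^m t⁻ᵐ` and `u` commutes with `P_p t`, the element `W = u^m P_{pm}` is `(P_p
t u)^m t⁻ᵐ`. Its first factor commutes with everything in sight, so `W` acts as `t⁻ᵐ`. -/
theorem seqRelations_of_central {x : ℕ → H} {t u : H} {p : ℕ}
    (hs : ∀ l, x (l + p) = t * x l * t⁻¹) (hx : ∀ l, Commute (x l) (prodTo x p * t * u))
    (ht : Commute t (prodTo x p * t * u)) (n m : ℕ) :
    SeqRelations (p * n) (p * m) x (t ^ n) (u ^ m) := by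
  have hW : u ^ m * prodTo x (p * m) = (prodTo x p * t * u) ^ m * (t ^ m)⁻¹ := by
    have h1 := prodTo_mul_add hs m 0
    rw [add_zero, prodTo_zero, mul_one, mul_comm m p] at h1
    have hu := commute_of_central hx ht
    rw [h1, ← mul_assoc, ← hu.eq, hu.mul_pow]
  refine ⟨conj_periodic_mul_add hs n, fun l => ?_, ?_⟩
  · rw [hW, conj_periodic_mul_add hs, ← mul_assoc, ((hx l).pow_right m).eq]
    group
  · rw [hW]
    exact ((ht.pow_left n).pow_right m).mul_right ((Commute.refl t).pow_pow n m).inv_right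

end Sequences

/-- The relations of torsion quotients, in terms of the extended sequence. -/
theorem torsionRelations_iff {H : Type*} [Group H] {N M p : ℕ} (hN : 0 < N)
    (hpN : p ∣ N) (hpM : p ∣ M)
    {K : Fin (Nat.gcd N M) → ℕ∞} {κ : ℕ → ℕ∞} (hK : ∀ i, K i = κ i)
    (hκ : Function.Periodic κ p) (b c : ℕ∞) {f : JBraidGen N → H} {x : ℕ → H}
    (hx : ∀ l : Fin N, x l = f (.x l)) (hs : ∀ l, x (l + N) = f .y * x l * (f .y)⁻¹) :
    TorsionRelations K b c f ↔ SeqRelations N M x (f .y) (f .z) ∧ (∀ l, PowEqOne (x l) (κ l)) ∧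
      PowEqOne (f .y) b ∧ PowEqOne (f .z) c := by
  constructor
  · intro h
    have hS := (lift_rels_iff hN hx hs).1 h.rels
    refine ⟨hS, fun l => ?_, h.y, h.z⟩
    have hg : l % Nat.gcd N M < Nat.gcd N M := Nat.mod_lt _ (Nat.gcd_pos_of_pos_left _ hN)
    have h1 := h.x ⟨l % Nat.gcd N M, hg⟩ ⟨l % Nat.gcd N M, hg.trans_le (Nat.gcd_le_left _ hN)⟩ rfl
    rw [← hx, hK] at h1
    -- The period `p` of `κ` divides the gcd.
    have h2 : κ (l % Nat.gcd N M) = κ l := by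
      obtain ⟨e, he⟩ := Nat.dvd_gcd hpN hpM
      conv_rhs => rw [← Nat.mod_add_div l (Nat.gcd N M)]
      rw [show Nat.gcd N M * (l / Nat.gcd N M) = (e * (l / Nat.gcd N M)) * p by
        rw [he]; ring]
      exact ((hκ.nat_mul _) _).symm
    rw [h2] at h1
    exact h1.of_isConj (hS.isConj (Nat.mod_modEq _ _))
  · rintro ⟨hS, hxt, hy, hz⟩
    refine ⟨(lift_rels_iff hN hx hs).2 hS, fun i l hil => ?_, hy, hz⟩
    rw [← hx, hK, hil]
    exact hxt i

namespace IsTorsionQuotient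

variable {N M p n m : ℕ} {K : Fin (Nat.gcd N M) → ℕ∞} {κ : ℕ → ℕ∞} {b c : ℕ∞} {G : Type} [Group G]
  {gen : JBraidGen N → G} {x : ℕ → G}

/-- The endomorphism which becomes the conjugation by `t` in the parent `J`-group. -/
theorem exists_translation (hG : IsTorsionQuotient K b c gen) (hN : 0 < N)
    (hpN : p ∣ N) (hpM : p ∣ M) (hK : ∀ i, K i = κ i) (hκ : Function.Periodic κ p)
    (hx : ∀ l : Fin N, x l = gen (.x l)) (hs : ∀ l, x (l + N) = gen .y * x l * (gen .y)⁻¹) :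
    ∃ α : G →* G, (∀ l, α (x l) = x (l + p)) ∧ α (gen .y) = gen .y ∧
      α (gen .z) = (prodTo x p)⁻¹ * gen .z * prodTo x p := by
  obtain ⟨hS, hxt, hy, hz⟩ :=
    (torsionRelations_iff hN hpN hpM hK hκ b c hx hs).1 hG.relations
  let f : JBraidGen N → G
    | .x l => x (l + p)
    | .y => gen .y
    | .z => (prodTo x p)⁻¹ * gen .z * prodTo x p
  have hS' := hS.translate p
  obtain ⟨α, hα⟩ := hG.exists_lift G f <|
    (torsionRelations_iff hN hpN hpM hK hκ b c (f := f) (x := fun l => x (l + p))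
      (fun _ => rfl) hS'.shift).2 ⟨hS', fun l => by simpa [hκ l] using hxt (l + p), hy,
        by simpa using hz.conj (prodTo x p)⁻¹⟩
  refine ⟨α, map_conj_periodic hN hs hS'.shift α (hα .y) fun l hl => ?_, hα .y, hα .z⟩
  rw [show l = (⟨l, hl⟩ : Fin N) from rfl, hx, hα]

/-- The torsion quotient embeds in a group in which `y` and `z` acquire roots `t` and `u` such that
`x_1 ⋯ x_p t u` is central and `t` acts on the sequence `x` as the translation by `p`. -/
theorem exists_extension (hG : IsTorsionQuotient K b c gen) (hn : 0 < n) (hm : 0 < m) (hp : 0 < p)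
    (hN : N = p * n) (hM : M = p * m) (hK : ∀ i, K i = κ i) (hκ : Function.Periodic κ p)
    (hx : ∀ l : Fin N, x l = gen (.x l)) (hs : ∀ l, x (l + N) = gen .y * x l * (gen .y)⁻¹) :
    ∃ (E : Type) (_ : Group E) (ι : G →* E) (t u : E), Function.Injective ι ∧
      t ^ n = ι (gen .y) ∧ u ^ m = ι (gen .z) ∧ (∀ l, t * ι (x l) * t⁻¹ = ι (x (l + p))) ∧
      ∀ e, Commute e (ι (prodTo x p) * t * u) := by
  have hN0 : 0 < N := hN ▸ Nat.mul_pos hp hn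
  have hpN : p ∣ N := ⟨n, hN⟩
  have hpM : p ∣ M := ⟨m, hM⟩
  obtain ⟨hS, -, -, -⟩ :=
    (torsionRelations_iff hN0 hpN hpM hK hκ b c hx hs).1 hG.relations
  obtain ⟨α, hαx, hαy, hαz⟩ := hG.exists_translation hN0 hpN hpM hK hκ hx hs
  have hαW : α (gen .z * prodTo x M) = gen .z * prodTo x M := by
    rw [map_mul, map_prodTo]
    simp only [hαx, hαz]
    exact hS.conj_eq p
  have hαn : ∀ g, α^[n] g = gen .y * g * (gen .y)⁻¹ := by
    let α' : Monoid.End G := α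
    let β : G →* G := α' ^ n
    have hβ : ∀ g, β g = α^[n] g := fun g => congrFun (Monoid.End.coe_pow G α' n) g
    have hβx : ∀ l, β (x l) = x (l + N) := by
      intro l
      rw [hβ, hN]
      generalize n = k
      induction k generalizing l with
      | zero => rfl
      | succ k ih => rw [Function.iterate_succ_apply, hαx, ih, Nat.mul_succ, add_assoc, add_comm p]
    have hβy : β (gen .y) = gen .y := (hβ _).trans (Function.iterate_fixed hαy n)
    -- The image of `z` is forced: `β` fixes `W = y W y⁻¹` and sends `P_M` to `y P_M y⁻¹`.
    have hβz : β (gen .z) = gen .y * gen .z * (gen .y)⁻¹ := by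
      have h1 : β (gen .z * prodTo x M) = gen .z * prodTo x M :=
        (hβ _).trans (Function.iterate_fixed hαW n)
      rw [map_mul, map_prodTo] at h1
      simp only [hβx, hs, prodTo_conj] at h1
      have h2 := mul_inv_eq_iff_eq_mul.2 hS.y_comm
      rw [← h2] at h1
      refine mul_right_cancel (h1.trans ?_)
      group
    have h : β = (MulAut.conj (gen .y)).toMonoidHom := by
      refine hom_ext_of_closure hG.closure_range ?_
      rintro (l | _ | _)
      · rw [← hx, hβx, hs]
        rfl
      · simp [hβy]
      · simp [hβz]
    intro g
    rw [← hβ, h]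
    rfl
  obtain ⟨E₁, _, ι₁, t₁, hι₁, ht₁, hα₁, hgen₁⟩ := exists_cyclic_extension hn α _ hαy hαn
  have hs₁ : ∀ l, ι₁ (x (l + p)) = t₁ * ι₁ (x l) * t₁⁻¹ := fun l => by rw [hα₁, hαx]
  set D := ι₁ (prodTo x p) * t₁ with hD
  have hw : ι₁ (gen .z * prodTo x M) * t₁ ^ m = ι₁ (gen .z) * D ^ m := by
    have h1 := prodTo_mul_add (x := fun l => ι₁ (x l)) hs₁ m 0
    rw [add_zero, prodTo_zero, mul_one, ← map_prodTo, ← map_prodTo, ← hD, mul_comm m p, ← hM,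
      eq_mul_inv_iff_mul_eq] at h1
    rw [map_mul, mul_assoc, h1]
  have hWt : Commute (ι₁ (gen .z * prodTo x M)) t₁ := by
    refine (mul_inv_eq_iff_eq_mul.1 ?_ : _ = _).symm
    rw [hα₁, hαW]
  -- Conjugation by `W` translates by `-M` and conjugation by `t₁^m` by `+M`, so their product is
  -- central.
  set w := ι₁ (gen .z * prodTo x M) * t₁ ^ m with hwdef
  have hwt : Commute w t₁ := hWt.mul_left (Commute.pow_self t₁ m)
  have hwx : ∀ l, Commute w (ι₁ (x l)) := by
    intro l
    have h1 := conj_periodic_mul_add (x := fun l => ι₁ (x l)) hs₁ m l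
    rw [← hM, eq_mul_inv_iff_mul_eq] at h1
    change _ * _ = _ * _
    rw [hwdef, mul_assoc, ← h1, ← mul_assoc, ← map_mul, ← hS.x_comm, map_mul, mul_assoc]
  have hwι : ∀ g, Commute w (ι₁ g) := by
    have h : (MulAut.conj w).toMonoidHom.comp ι₁ = ι₁ := by
      refine hom_ext_of_closure hG.closure_range fun a => ?_
      suffices Commute w (ι₁ (gen a)) by simp [this.eq]
      rcases a with l | _ | _
      · rw [← hx]
        exact hwx l
      · rw [← ht₁]
        exact hwt.pow_right n
      -- `z` is reached as `W P_M⁻¹`, both factors of which commute with `w`.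
      · have h1 : Commute w (ι₁ (prodTo x M)) := by
          generalize M = k
          induction k with
          | zero => simp [prodTo_zero]
          | succ k ih => rw [prodTo_succ, map_mul]; exact ih.mul_right (hwx k)
        have h2 : Commute w (ι₁ (gen .z * prodTo x M)) :=
          (Commute.refl _).mul_left (hWt.pow_right m).symm
        rw [map_mul] at h2
        simpa using h2.mul_right h1.inv_right
    intro g
    exact mul_inv_eq_iff_eq_mul.1 (DFunLike.congr_fun h g)
  have hwc : ∀ e, Commute w e := by
    intro e
    obtain ⟨g, k, rfl⟩ := hgen₁ e
    exact (hwι g).mul_right (hwt.zpow_right k)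
  -- A central element gets an `m`-th root from the cyclic extension with trivial action.
  obtain ⟨E, _, ι₂, Z, hι₂, hZ, hZι, hgen₂⟩ := exists_cyclic_extension hm (MonoidHom.id E₁) w rfl
    (fun e => by simp [(hwc e).eq])
  have hZc : ∀ e, Commute e Z := by
    intro e
    obtain ⟨g, k, rfl⟩ := hgen₂ e
    exact (Commute.mul_right (mul_inv_eq_iff_eq_mul.1 (hZι g)) (Commute.self_zpow Z k)).symm
  -- `u = D⁻¹ Z` gives `u^m = D⁻ᵐ w = z`, because `w = z D^m` is central, and makes `D u = Z`.
  refine ⟨E, inferInstance, ι₂.comp ι₁, ι₂ t₁, (ι₂ D)⁻¹ * Z, hι₂.comp hι₁, ?_, ?_, ?_, ?_⟩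
  · rw [← map_pow, ht₁]
    rfl
  · rw [(hZc _).mul_pow, hZ, inv_pow, ← map_pow, ← map_inv, ← map_mul,
      ((hwc (D ^ m)⁻¹).symm).eq, hw, mul_inv_cancel_right]
    rfl
  · intro l
    simp [hs₁]
  · intro e
    have h1 : ι₂.comp ι₁ (prodTo x p) * ι₂ t₁ = ι₂ D := by simp [hD]
    rw [h1, mul_inv_cancel_left]
    exact hZc e

end IsTorsionQuotient

end JBraid

/-! ### The embedding in a parent `J`-group and the action of the latter on the image. -/

namespace JBraid

/-- Meant for conditions "conjugation by `g` maps a set into itself", where stability under inverses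
is clear only for suitable generators. -/
theorem mem_submonoid_of_closure_eq_top {G : Type*} [Group G] {S : Set G}
    (hS : Subgroup.closure S = ⊤) (A : Submonoid G) (h : ∀ s ∈ S, s ∈ A ∧ s⁻¹ ∈ A) (g : G) :
    g ∈ A := by
  have hg : g ∈ (Subgroup.closure S).toSubmonoid := by rw [hS]; trivial
  rw [Subgroup.closure_toSubmonoid] at hg
  refine (Submonoid.closure_le.2 ?_) hg
  rintro s (hs | hs)
  · exact (h s hs).1
  · simpa using (h _ hs).2

/-- A criterion for a morphism to `J(K)` to exhibit its source as `J(K / K')`. -/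
theorem exhibitsAs_of_conj {ι G : Type*} [Group G] {p : ℕ} {K : Fin p → ℕ∞} {K' : Fin p → ℕ}
    {gen : ι → G} (hgen : Subgroup.closure (Set.range gen) = ⊤) {φ : G →* JGroup K}
    (hφ : Function.Injective φ)
    (hs : ∀ a, ∃ i g, φ (gen a) = g * JGroup.s K i ^ K' i * g⁻¹)
    (hs' : ∀ i, ∃ a, JGroup.s K i ^ K' i = φ (gen a))
    (hconj : ∀ g a, ∃ a' h, g * φ (gen a) * g⁻¹ = φ (h * gen a' * h⁻¹)) :
    ExhibitsAs (genReflections gen) K K' φ := by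
  -- Normality makes the image contain the normal closure of the `s_i ^ k'_i` as soon as it contains
  -- these elements.
  have hnormal : φ.range.Normal := by
    refine ⟨fun r hr g => ?_⟩
    obtain ⟨r, rfl⟩ := hr
    have h1 : Subgroup.closure (Set.range gen) ≤
        φ.range.comap ((MulAut.conj g).toMonoidHom.comp φ) := by
      rw [Subgroup.closure_le]
      rintro _ ⟨a, rfl⟩
      obtain ⟨a', h, hh⟩ := hconj g a
      exact ⟨_, hh.symm⟩
    rw [hgen] at h1
    exact h1 (Subgroup.mem_top r)
  have hmem : ∀ g, φ g ∈ GenJGroup K K' := by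
    have : (GenJGroup K K').Normal := Subgroup.normalClosure_normal
    have h1 : Subgroup.closure (Set.range gen) ≤ (GenJGroup K K').comap φ := by
      rw [Subgroup.closure_le]
      rintro _ ⟨a, rfl⟩
      obtain ⟨i, g, hg⟩ := hs a
      change φ (gen a) ∈ GenJGroup K K'
      rw [hg]
      exact this.conj_mem _ (Subgroup.subset_normalClosure ⟨i, rfl⟩) g
    rw [hgen] at h1
    exact fun g => h1 (Subgroup.mem_top g)
  refine ⟨hφ, le_antisymm ?_ ?_, Set.Subset.antisymm ?_ ?_⟩
  · rintro _ ⟨g, rfl⟩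
    exact hmem g
  · refine Subgroup.normalClosure_le_normal ?_
    rintro _ ⟨i, rfl⟩
    obtain ⟨a, ha⟩ := hs' i
    exact ⟨gen a, ha.symm⟩
  · rintro _ ⟨_, ⟨hr, a, h, e, rfl⟩, rfl⟩
    refine ⟨⟨_, hmem _⟩, ⟨?_, ?_⟩, rfl⟩
    · rw [Ne, Subgroup.mk_eq_one]
      exact fun h1 => hr ((injective_iff_map_eq_one φ).1 hφ _ h1)
    · obtain ⟨i, g, hg⟩ := hs a
      refine ⟨i, e, φ h * g, ?_⟩
      change φ _ = _
      rw [← conj_zpow, map_zpow, map_mul, map_mul, hg]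
      simp [mul_assoc]
  · rintro _ ⟨r, ⟨hr, i, e, g, hg⟩, rfl⟩
    obtain ⟨a, ha⟩ := hs' i
    obtain ⟨a', h, hh⟩ := hconj g a
    rw [ha, ← conj_zpow, hh, ← map_zpow] at hg
    refine ⟨_, ⟨?_, a', h, e, rfl⟩, hg.symm⟩
    intro h1
    rw [h1, map_one] at hg
    exact hr (Subtype.ext hg)

section extTuple

variable {A : Type*} {p : ℕ} (f : Fin p → A) (b c : A)

theorem extTuple_castAdd (i : Fin p) : extTuple f b c (Fin.castAdd 2 i) = f i := by
  simp [extTuple]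

theorem extTuple_natAdd_zero : extTuple f b c (Fin.natAdd p 0) = b := by simp [extTuple]

theorem extTuple_natAdd_one : extTuple f b c (Fin.natAdd p 1) = c := by simp [extTuple]

theorem forall_fin_add_two {P : Fin (p + 2) → Prop} (h : ∀ i, P (Fin.castAdd 2 i))
    (h₀ : P (Fin.natAdd p 0)) (h₁ : P (Fin.natAdd p 1)) (i : Fin (p + 2)) : P i := by
  refine Fin.addCases h (fun i => ?_) i
  fin_cases i
  exacts [h₀, h₁]

theorem eq_extTuple (g : Fin (p + 2) → A) :
    g = extTuple (fun i => g (Fin.castAdd 2 i)) (g (Fin.natAdd p 0)) (g (Fin.natAdd p 1)) :=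
  funext <| forall_fin_add_two (fun _ => by rw [extTuple_castAdd])
    (by rw [extTuple_natAdd_zero]) (by rw [extTuple_natAdd_one])

end extTuple

namespace IsTorsionQuotient

variable {N M p n m : ℕ} {K : Fin (Nat.gcd N M) → ℕ∞} {K₀ : Fin p → ℕ∞} {b c : ℕ∞}
  {G : Type} [Group G] {gen : JBraidGen N → G}

set_option maxHeartbeats 1000000 in
/-- The embedding of a torsion quotient in a parent `J`-group. -/
theorem exists_embedding (hG : IsTorsionQuotient K b c gen) (hn : 0 < n) (hm : 0 < m) (hp : 0 < p)
    (hN : N = p * n) (hM : M = p * m)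
    (hK : ∀ i : Fin (Nat.gcd N M), K i = K₀ ⟨(i : ℕ) % p, Nat.mod_lt _ hp⟩)
    {L : Fin (p + 2) → ℕ∞} (hL : ∀ i, L (Fin.castAdd 2 i) = K₀ i)
    (hLb : L (Fin.natAdd p 0) = b * n) (hLc : L (Fin.natAdd p 1) = c * m)
    {L' : Fin (p + 2) → ℕ} (hL' : ∀ i, L' (Fin.castAdd 2 i) = 1)
    (hLn : L' (Fin.natAdd p 0) = n) (hLm : L' (Fin.natAdd p 1) = m) :
    ∃ φ : G →* JGroup L,
      (∀ l : Fin N, φ (gen (.x l)) = JGroup.s _ (Fin.natAdd p 0) ^ ((l : ℕ) / p) *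
        JGroup.s _ (Fin.castAdd 2 ⟨(l : ℕ) % p, Nat.mod_lt _ hp⟩) *
          (JGroup.s _ (Fin.natAdd p 0) ^ ((l : ℕ) / p))⁻¹) ∧
      φ (gen .y) = JGroup.s _ (Fin.natAdd p 0) ^ n ∧
      φ (gen .z) = JGroup.s _ (Fin.natAdd p 1) ^ m ∧
      ExhibitsAs (genReflections gen) L L' φ := by
  have hN0 : 0 < N := hN ▸ Nat.mul_pos hp hn
  have hpN : p ∣ N := ⟨n, hN⟩
  have hpM : p ∣ M := ⟨m, hM⟩
  let κ : ℕ → ℕ∞ := fun l => K₀ ⟨l % p, Nat.mod_lt _ hp⟩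
  have hκ : Function.Periodic κ p := fun l => by simp [κ]
  obtain ⟨x, hx, hs⟩ := exists_conj_periodic hN0 (fun l => gen (.x l)) (gen .y)
  obtain ⟨hS, -, -, -⟩ :=
    (torsionRelations_iff hN0 hpN hpM (κ := κ) hK hκ b c hx hs).1 hG.relations
  obtain ⟨α, hαx, hαy, hαz⟩ := hG.exists_translation hN0 hpN hpM (κ := κ) hK hκ hx hs
  have hZ := JGroup.commute_ofFn_prod L
  have hpow := JGroup.powEqOne_s L
  rw [eq_extTuple (JGroup.s L), JGroup.ofFn_extTuple_prod] at hZ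
  set s : Fin p → JGroup L := fun i => JGroup.s _ (Fin.castAdd 2 i)
  set t : JGroup L := JGroup.s _ (Fin.natAdd p 0)
  set u : JGroup L := JGroup.s _ (Fin.natAdd p 1)
  -- The counterpart in `J` of the sequence `x`, with period `p` under the root `t` instead of `N`
  -- under `y`.
  obtain ⟨σ, hσ, hσs⟩ := exists_conj_periodic hp s t
  have hσl : ∀ l, σ l = t ^ (l / p) * s ⟨l % p, Nat.mod_lt _ hp⟩ * (t ^ (l / p))⁻¹ := by
    intro l
    rw [← hσ, ← conj_periodic_mul_add hσs, Nat.mod_add_div]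
  rw [ofFn_prod hσ] at hZ
  have huXt : Commute u (prodTo σ p * t) := commute_of_central (fun _ => hZ _) (hZ _)
  have hclosure : Subgroup.closure (Set.range s ∪ {t, u}) = ⊤ := by
    rw [eq_top_iff, ← JGroup.closure_range_s, Subgroup.closure_le]
    rintro _ ⟨i, rfl⟩
    refine Subgroup.subset_closure ?_
    exact forall_fin_add_two (P := fun i => JGroup.s _ i ∈ Set.range s ∪ {t, u})
      (fun i => Or.inl ⟨i, rfl⟩) (Or.inr (Or.inl rfl)) (Or.inr (Or.inr rfl)) i
  let f : JBraidGen N → JGroup L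
    | .x l => σ l
    | .y => t ^ n
    | .z => u ^ m
  have hσS : SeqRelations N M σ (t ^ n) (u ^ m) := by
    rw [hN, hM]
    exact seqRelations_of_central hσs (fun _ => hZ _) (hZ _) n m
  have hf : TorsionRelations K b c f := by
    refine (torsionRelations_iff hN0 hpN hpM (κ := κ) hK hκ b c (f := f) (x := σ)
      (fun _ => rfl) hσS.shift).2 ⟨hσS, fun l => ?_, ?_, ?_⟩
    · rw [hσl]
      refine PowEqOne.conj ?_ _
      have := hpow (Fin.castAdd 2 ⟨l % p, Nat.mod_lt _ hp⟩)
      rwa [hL] at this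
    · refine (powEqOne_mul_iff hn).1 ?_
      have := hpow (Fin.natAdd p 0)
      rwa [hLb] at this
    · refine (powEqOne_mul_iff hm).1 ?_
      have := hpow (Fin.natAdd p 1)
      rwa [hLc] at this
  obtain ⟨φ, hφ⟩ := hG.exists_lift _ f hf
  have hφx : ∀ l, φ (x l) = σ l :=
    map_conj_periodic hN0 hs hσS.shift φ (hφ .y) fun l hl => by
      rw [show l = (⟨l, hl⟩ : Fin N) from rfl, hx, hφ]
  have hφP : ∀ k, φ (prodTo x k) = prodTo σ k := fun k => by
    rw [map_prodTo]
    simp only [hφx]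
  refine ⟨φ, fun l => (hφ _).trans (hσl _), hφ .y, hφ .z, exhibitsAs_of_conj hG.closure_range ?_
    ?_ ?_ ?_⟩
  -- Injectivity: the extension `E` satisfies the relations of `J(L)`, and the resulting `ψ` has `ψ
  -- ∘ φ = ι`, which is injective.
  · obtain ⟨E, _, ι, t', u', hι, ht', hu', hιx, hEZ⟩ :=
      hG.exists_extension hn hm hp hN hM (κ := κ) hK hκ hx hs
    obtain ⟨-, hxt, hy, hz⟩ :=
      (torsionRelations_iff hN0 hpN hpM (κ := κ) hK hκ b c hx hs).1 hG.relations
    have htors : ∀ i, PowEqOne (extTuple (fun i : Fin p => ι (x i)) t' u' i)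
        (L i) := by
      refine forall_fin_add_two (fun i => ?_) ?_ ?_
      · have := (hxt i).map ι
        simp only [κ, Nat.mod_eq_of_lt i.2] at this
        rwa [extTuple_castAdd, hL]
      · rw [extTuple_natAdd_zero, hLb, powEqOne_mul_iff hn, ht']
        exact hy.map ι
      · rw [extTuple_natAdd_one, hLc, powEqOne_mul_iff hm, hu']
        exact hz.map ι
    obtain ⟨ψ, hψ⟩ := JGroup.exists_lift L (extTuple (fun i : Fin p => ι (x i)) t' u') (fun i => by
        rw [JGroup.ofFn_extTuple_prod, ofFn_prod (x := fun l => ι (x l)) (fun _ => rfl),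
          ← map_prodTo]
        exact hEZ _) htors
    have hψt : ψ t = t' := (hψ _).trans (extTuple_natAdd_zero _ _ _)
    have hψu : ψ u = u' := (hψ _).trans (extTuple_natAdd_one _ _ _)
    have hψσ : ∀ l, ψ (σ l) = ι (x l) := by
      refine map_conj_periodic (x' := fun l => ι (x l)) hp hσs (fun l => (hιx l).symm) ψ hψt
        fun l hl => ?_
      rw [show l = (⟨l, hl⟩ : Fin p) from rfl, hσ]
      exact (hψ _).trans (extTuple_castAdd _ _ _ _)
    have h : ψ.comp φ = ι := by
      refine hom_ext_of_closure hG.closure_range ?_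
      rintro (l | _ | _)
      · rw [← hx, MonoidHom.comp_apply, hφx, hψσ]
      · rw [MonoidHom.comp_apply, hφ, map_pow, hψt, ht']
      · rw [MonoidHom.comp_apply, hφ, map_pow, hψu, hu']
    refine Function.Injective.of_comp (f := ψ) ?_
    rw [← MonoidHom.coe_comp, h]
    exact hι
  · rintro (l | _ | _)
    · refine ⟨Fin.castAdd 2 ⟨(l : ℕ) % p, Nat.mod_lt _ hp⟩, t ^ ((l : ℕ) / p), ?_⟩
      rw [hL', pow_one]
      exact (hφ _).trans (hσl l)
    · refine ⟨Fin.natAdd p 0, 1, ?_⟩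
      rw [hLn, one_mul, inv_one, mul_one]
      exact hφ _
    · refine ⟨Fin.natAdd p 1, 1, ?_⟩
      rw [hLm, one_mul, inv_one, mul_one]
      exact hφ _
  · refine forall_fin_add_two (P := fun i => ∃ a, JGroup.s L i ^ L' i = φ (gen a))
      (fun i => ?_) ⟨.y, ?_⟩ ⟨.z, ?_⟩
    · refine ⟨.x ⟨i, i.2.trans_le (Nat.le_of_dvd hN0 hpN)⟩, ?_⟩
      rw [hL', pow_one]
      exact ((hφ (.x _)).trans (hσ i)).symm
    · rw [hLn]
      exact (hφ .y).symm
    · rw [hLm]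
      exact (hφ .z).symm
  · have htα : ∀ g, t * φ g * t⁻¹ = φ (α g) := by
      have h : (MulAut.conj t).toMonoidHom.comp φ = φ.comp α := by
        refine hom_ext_of_closure hG.closure_range ?_
        rintro (l | _ | _)
        · rw [← hx, MonoidHom.comp_apply, MonoidHom.comp_apply, hαx, hφx, hφx, hσs]
          rfl
        · rw [MonoidHom.comp_apply, MonoidHom.comp_apply, hαy, hφ]
          simp [f, ← pow_succ', pow_succ]
        · rw [MonoidHom.comp_apply, MonoidHom.comp_apply, hαz, map_mul, map_mul, map_inv, hφ, hφP]
          change t * u ^ m * t⁻¹ = _ * u ^ m * _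
          -- `u` commutes with `P_p t`, so conjugating `u^m` by `t` or by `P_p⁻¹` gives the same
          -- result.
          have h1 : Commute (u ^ m) (prodTo σ p * t) := huXt.pow_left m
          rw [mul_inv_eq_iff_eq_mul, mul_assoc, mul_assoc, h1.eq]
          group
      exact fun g => DFunLike.congr_fun h g
    have hαgen : ∀ a, ∃ a' k, α (gen a) = k * gen a' * k⁻¹ := by
      rintro (l | _ | _)
      -- The index `l + p` may exceed `N`; it is brought back by a power of `y`.
      · refine ⟨.x ⟨(l + p) % N, Nat.mod_lt _ hN0⟩, gen .y ^ ((l + p) / N), ?_⟩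
        rw [← hx, ← hx, ← conj_periodic_mul_add hs, hαx, Nat.mod_add_div]
      · exact ⟨.y, 1, by simp [hαy]⟩
      · exact ⟨.z, (prodTo x p)⁻¹, by simp [hαz]⟩
    let A : Submonoid (JGroup L) :=
      { carrier := {g | ∀ a h, ∃ a' h',
          g * φ (h * gen a * h⁻¹) * g⁻¹ = φ (h' * gen a' * h'⁻¹)}
        one_mem' := fun a h => ⟨a, h, by simp⟩
        mul_mem' := by
          intro g₁ g₂ h₁ h₂ a h
          obtain ⟨a', h', e⟩ := h₂ a h
          obtain ⟨a'', h'', e'⟩ := h₁ a' h'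
          exact ⟨a'', h'', by rw [← e', ← e]; group⟩ }
    have hAφ : ∀ g, φ g ∈ A := fun g a h =>
      ⟨a, g * h, by rw [← map_inv, ← map_mul, ← map_mul]; group⟩
    have hAZ : ∀ Z, (∀ g, Commute Z g) → Z ∈ A := fun Z hZ a h =>
      ⟨a, h, by rw [(hZ _).eq, mul_inv_cancel_right]⟩
    have hAt : t ∈ A := by
      intro a h
      obtain ⟨a', k, hk⟩ := hαgen a
      refine ⟨a', α h * k, ?_⟩
      rw [htα, map_mul α, map_mul α, hk, map_inv α]
      group
    have hAt' : t⁻¹ ∈ A := by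
      -- `t^n` lies in the image, so `t⁻¹` is a nonnegative power of `t` times an element of the
      -- image.
      have h1 : t⁻¹ = t ^ (n - 1) * φ (gen .y)⁻¹ := by
        rw [map_inv, hφ]
        obtain ⟨n, rfl⟩ := Nat.exists_eq_add_of_le' hn
        simp [f, pow_succ']
      rw [h1]
      exact A.mul_mem (A.pow_mem hAt _) (hAφ _)
    have hA : ∀ g, g ∈ A := by
      refine mem_submonoid_of_closure_eq_top hclosure A ?_
      rintro _ (⟨i, rfl⟩ | rfl | rfl)
      · rw [← hσ, ← hφx, ← map_inv]
        exact ⟨hAφ _, hAφ _⟩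
      · exact ⟨hAt, hAt'⟩
      -- `u` and `u⁻¹` are products of `t^{±1}`, an element of the image and a central element.
      · have h1 : u = t⁻¹ * φ (prodTo x p)⁻¹ * (prodTo σ p * t * u) := by
          rw [map_inv, hφP]
          group
        have h2 : u⁻¹ = (prodTo σ p * t * u)⁻¹ * φ (prodTo x p) * t := by
          rw [hφP]
          group
        constructor
        · rw [h1]
          exact A.mul_mem (A.mul_mem hAt' (hAφ _)) (hAZ _ fun g => (hZ g).symm)
        · rw [h2]
          exact A.mul_mem (A.mul_mem (hAZ _ fun g => (hZ g).symm.inv_left) (hAφ _)) hAt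
    intro g a
    simpa using hA g a 1

end IsTorsionQuotient

end JBraid

/-! ### Passage to the four families of torsion quotients. -/

theorem ExhibitsAs.reflIso {W : Type*} [Group W] {R : Set W} {p : ℕ} {K : Fin p → ℕ∞}
    {K' : Fin p → ℕ} {f : W →* JGroup K} (h : ExhibitsAs R K K' f) :
    ReflIso R (GenJGroup.reflections K K') := by
  obtain ⟨hinj, hrange, himage⟩ := h
  let e : W ≃* GenJGroup K K' := (f.ofInjective hinj).trans (MulEquiv.subgroupCongr hrange)
  have he : ∀ w, (e w : JGroup K) = f w := fun _ => rfl
  refine ⟨e, Subtype.val_injective.image_injective ?_⟩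
  rw [← himage, ← Set.image_comp]
  exact Set.image_congr fun w _ => he w

theorem JGroup.proj_s {p : ℕ} {K L : Fin p → ℕ∞} (h : ∀ i, L i ∣ K i) (i : Fin p) :
    JGroup.proj h (JGroup.s K i) = JGroup.s L i :=
  PresentedGroup.toGroup.of _

theorem JBraid.extProj_embeddingGen {p : ℕ} (n m : ℕ) (K : Fin p → ℕ∞) {b b' c c' : ℕ∞}
    (hb : b' ∣ b) (hc : c' ∣ c) (a : JBraidGen (p * n)) :
    JGroup.extProj K hb hc (embeddingGen n m K b c a) = embeddingGen n m K b' c' a := by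
  have h : ∀ i, JGroup.extProj K hb hc (JGroup.s _ i) = JGroup.s _ i := JGroup.proj_s _
  rcases a with l | _ | _
  · simp only [embeddingGen, map_mul, map_pow, map_inv, h]
  · simp only [embeddingGen, map_pow, h]
  · simp only [embeddingGen, map_pow, h]

/-- The form of `IsTorsionQuotient.exists_embedding` for the tuple `d · K`. -/
theorem JBraid.IsTorsionQuotient.exists_embeddingGen {p n m : ℕ} (hp : 0 < p) (hn : 0 < n)
    (hm : 0 < m) {K : Fin p → ℕ∞} {b c B C : ℕ∞} {G : Type} [Group G]
    {gen : JBraidGen (p * n) → G}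
    (hG : IsTorsionQuotient (M := p * m) (repeatTuple n m K) b c gen)
    (hB : B = b * n) (hC : C = c * m) :
    ∃ φ : G →* JGroup (extTuple K B C), (∀ a, φ (gen a) = embeddingGen n m K B C a) ∧
      ExhibitsAs (genReflections gen) (extTuple K B C) (extTuple (fun _ => 1) n m) φ := by
  obtain ⟨φ, hx, hy, hz, hφ⟩ := hG.exists_embedding (K₀ := K) hn hm hp rfl rfl (fun _ => rfl)
    (extTuple_castAdd K B C) ((extTuple_natAdd_zero K B C).trans hB)
    ((extTuple_natAdd_one K B C).trans hC) (extTuple_castAdd _ n m) (extTuple_natAdd_zero _ n m)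
    (extTuple_natAdd_one _ n m)
  refine ⟨φ, ?_, hφ⟩
  rintro (l | _ | _)
  exacts [hx l, hy, hz]

/-- This is the embedding with `p = gcd(n, m)`, where the tuple is not repeated at all: reduction of
its indices modulo `p` changes nothing. -/
theorem JBraid.IsTorsionQuotient.reflIso {n m : ℕ} (hn : 0 < n) (hm : 0 < m)
    {K : Fin (Nat.gcd n m) → ℕ∞} {b c B C : ℕ∞} {G : Type} [Group G] {gen : JBraidGen n → G}
    (hG : IsTorsionQuotient K b c gen) (hB : B = b * (n / Nat.gcd n m : ℕ))
    (hC : C = c * (m / Nat.gcd n m : ℕ)) :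
    ReflIso (genReflections gen) (GenJGroup.reflections (extTuple K B C)
      (extTuple (fun _ => 1) (n / Nat.gcd n m) (m / Nat.gcd n m))) := by
  have hd : 0 < Nat.gcd n m := Nat.gcd_pos_of_pos_left _ hn
  obtain ⟨φ, -, -, -, hφ⟩ := hG.exists_embedding (K₀ := K)
    (Nat.div_pos (Nat.gcd_le_left _ hn) hd) (Nat.div_pos (Nat.gcd_le_right _ hm) hd) hd
    (Nat.mul_div_cancel' (Nat.gcd_dvd_left n m)).symm
    (Nat.mul_div_cancel' (Nat.gcd_dvd_right n m)).symm
    (fun i => congrArg K (Fin.ext (Nat.mod_eq_of_lt i.2).symm))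
    (extTuple_castAdd K B C) ((extTuple_natAdd_zero K B C).trans hB)
    ((extTuple_natAdd_one K B C).trans hC) (extTuple_castAdd _ _ _) (extTuple_natAdd_zero _ _ _)
    (extTuple_natAdd_one _ _ _)
  exact hφ.reflIso

theorem corollary4p15 :
    -- the explicit embeddings, for `K = (k_1, …, k_p)`
    (∀ (p n m : ℕ), 0 < p → 0 < n → 0 < m →
      ∀ K : Fin p → ℕ∞, (∀ i, 2 ≤ K i) → ∀ b c : ℕ∞, 2 ≤ b → 2 ≤ c →
      ∃ (φ : TBoth (p * n) (p * m) (repeatTuple n m K) b c →* JGroup (extTuple K (b * n) (c * m)))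
        (φUp : TUp (p * n) (p * m) (repeatTuple n m K) c →* JGroup (extTuple K n (c * m)))
        (φLow : TLow (p * n) (p * m) (repeatTuple n m K) b →* JGroup (extTuple K (b * n) m))
        (φCirc : TCirc (p * n) (p * m) (repeatTuple n m K) →* JGroup (extTuple K n m)),
        -- they are given by the explicit correspondence on the generators
        (∀ a, φ (TBoth.gen _ b c a) = embeddingGen n m K (b * n) (c * m) a) ∧
        (∀ a, φUp (TUp.gen _ c a) = embeddingGen n m K n (c * m) a) ∧
        (∀ a, φLow (TLow.gen _ b a) = embeddingGen n m K (b * n) m a) ∧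
        (∀ a, φCirc (TCirc.gen _ a) = embeddingGen n m K n m a) ∧
        -- the last three are induced by the first one
        (∀ w, φUp (TBoth.toUp _ b c w) =
          JGroup.extProj K (dvd_mul_left (n : ℕ∞) b) (dvd_refl (c * m)) (φ w)) ∧
        (∀ w, φLow (TBoth.toLow _ b c w) =
          JGroup.extProj K (dvd_refl (b * n)) (dvd_mul_left (m : ℕ∞) c) (φ w)) ∧
        (∀ w, φCirc (TBoth.toCirc _ b c w) =
          JGroup.extProj K (dvd_mul_left (n : ℕ∞) b) (dvd_mul_left (m : ℕ∞) c) (φ w)) ∧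
        -- they are embeddings onto generalized `J`-groups, compatible with reflections
        ExhibitsAs (TBoth.reflections _ _ _ b c)
          (extTuple K (b * n) (c * m)) (extTuple (fun _ => 1) n m) φ ∧
        ExhibitsAs (TUp.reflections _ _ _ c)
          (extTuple K n (c * m)) (extTuple (fun _ => 1) n m) φUp ∧
        ExhibitsAs (TLow.reflections _ _ _ b)
          (extTuple K (b * n) m) (extTuple (fun _ => 1) n m) φLow ∧
        ExhibitsAs (TCirc.reflections _ _ _)
          (extTuple K n m) (extTuple (fun _ => 1) n m) φCirc) ∧
    -- the resulting reflection isomorphisms, for `K = (k_1, …, k_d)` with `d = gcd(n, m)`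
    (∀ (n m : ℕ), 0 < n → 0 < m →
      ∀ K : Fin (Nat.gcd n m) → ℕ∞, (∀ i, 2 ≤ K i) → ∀ b c : ℕ∞, 2 ≤ b → 2 ≤ c →
      ∀ n' m' : ℕ, n' = n / Nat.gcd n m → m' = m / Nat.gcd n m →
        ReflIso (TBoth.reflections n m K b c)
          (GenJGroup.reflections (extTuple K (b * n') (c * m')) (extTuple (fun _ => 1) n' m')) ∧
        ReflIso (TUp.reflections n m K c)
          (GenJGroup.reflections (extTuple K n' (c * m')) (extTuple (fun _ => 1) n' m')) ∧
        ReflIso (TLow.reflections n m K b)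
          (GenJGroup.reflections (extTuple K (b * n') m') (extTuple (fun _ => 1) n' m')) ∧
        ReflIso (TCirc.reflections n m K)
          (GenJGroup.reflections (extTuple K n' m') (extTuple (fun _ => 1) n' m'))) := by
  refine ⟨?_, ?_⟩
  · intro p n m hp hn hm K _ b c _ _
    obtain ⟨φ, h, hE⟩ :=
      (TBoth.isTorsionQuotient (repeatTuple n m K) b c).exists_embeddingGen hp hn hm rfl rfl
    -- Killing `y` is the exponent `b = 1`, so the entry `b n` becomes `1 * n`; likewise below for
    -- `z`.
    obtain ⟨φUp, hUp, hEUp⟩ :=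
      (TUp.isTorsionQuotient (repeatTuple n m K) c).exists_embeddingGen hp hn hm
        (one_mul _).symm rfl
    obtain ⟨φLow, hLow, hELow⟩ :=
      (TLow.isTorsionQuotient (repeatTuple n m K) b).exists_embeddingGen hp hn hm
        rfl (one_mul _).symm
    obtain ⟨φCirc, hCirc, hECirc⟩ :=
      (TCirc.isTorsionQuotient (repeatTuple n m K)).exists_embeddingGen hp hn hm
        (one_mul _).symm (one_mul _).symm
    have hgen := (TBoth.isTorsionQuotient (repeatTuple n m K) b c).closure_range
    refine ⟨φ, φUp, φLow, φCirc, h, hUp, hLow, hCirc, ?_, ?_, ?_, ?_, ?_, ?_, ?_⟩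
    · refine DFunLike.congr_fun (f := φUp.comp (TBoth.toUp _ b c))
        (g := (JGroup.extProj K (dvd_mul_left _ _) (dvd_refl _)).comp φ)
        (hom_ext_of_closure hgen fun a => ?_)
      rw [MonoidHom.comp_apply, MonoidHom.comp_apply, h, extProj_embeddingGen]
      exact hUp a
    · refine DFunLike.congr_fun (f := φLow.comp (TBoth.toLow _ b c))
        (g := (JGroup.extProj K (dvd_refl _) (dvd_mul_left _ _)).comp φ)
        (hom_ext_of_closure hgen fun a => ?_)
      rw [MonoidHom.comp_apply, MonoidHom.comp_apply, h, extProj_embeddingGen]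
      exact hLow a
    · refine DFunLike.congr_fun (f := φCirc.comp (TBoth.toCirc _ b c))
        (g := (JGroup.extProj K (dvd_mul_left _ _) (dvd_mul_left _ _)).comp φ)
        (hom_ext_of_closure hgen fun a => ?_)
      rw [MonoidHom.comp_apply, MonoidHom.comp_apply, h, extProj_embeddingGen]
      exact hCirc a
    · rwa [TBoth.reflections_eq]
    · rwa [TUp.reflections_eq]
    · rwa [TLow.reflections_eq]
    · rwa [TCirc.reflections_eq]
  · rintro n m hn hm K - b c - - _ _ rfl rfl
    rw [TBoth.reflections_eq, TUp.reflections_eq, TLow.reflections_eq, TCirc.reflections_eq]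
    exact ⟨(TBoth.isTorsionQuotient K b c).reflIso hn hm rfl rfl,
      (TUp.isTorsionQuotient K c).reflIso hn hm (one_mul _).symm rfl,
      (TLow.isTorsionQuotient K b).reflIso hn hm rfl (one_mul _).symm,
      (TCirc.isTorsionQuotient K).reflIso hn hm (one_mul _).symm (one_mul _).symm⟩
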